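/- All manifolds are finite-dimensional, real, connected, Hausdorff, second countable and $C^\infty$; all maps, forms, functions and vector fields are $C^\infty$. A presymplectic form is a closed, degenerate $2$-form whose kernel has constant dimension. Let $(P,\omega)$ be a presymplectic manifold and $\mathcal H\in C^\infty(P)$ such that the equation $i(X)\omega=d\mathcal H$ has no solution $X\in\mathfrak X(P)$ (the system $(P,\omega,\mathcal H)$ is non-compatible). Let $j_M\colon M\hookrightarrow P$ be the final constraint submanifold, that is, a closed embedded submanifold, maximal with the property that there is $X\in\mathfrak X(P)$ tangent to $M$ with $[i(X)\omega-d\mathcal H]|_M=0$. Put $\Omega=j_M^*\omega$ and $H=j_M^*\mathcal H$. Let $G$ be a connected Lie group with Lie algebra $\mathfrak g$, acting on $P$ by an action $\Psi$ that leaves $M$ invariant. Assume that the induced action $\Phi$ on $M$ satisfies $\Phi_g^*\Omega=\Omega$ and $\Phi_g^*H=H$ for all $g\in G$ and is free, proper and Poissonian. Here a momentum map is a map $\mathcal J\colon M\to\mathfrak g^*$ such that, for every $\xi\in\mathfrak g$, with $\tilde\xi$ the fundamental vector field of $\xi$ on $M$ and $f_\xi(x)=\mathcal J(x)(\xi)$,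 one has $i(\tilde\xi)\Omega=df_\xi$; the action is Poissonian if there is a momentum map with $f_{[\xi,\zeta]}=\Omega(\tilde\xi,\tilde\zeta)$ for all $\xi,\zeta\in\mathfrak g$. Assume moreover: 1. every vector field $Z\in\mathfrak X(M)$ with $i(Z)\Omega=0$ is a finite sum $Z=\sum_i f^i\,\tilde\xi_i$ with $f^i\in C^\infty(M)$ and $\xi_i\in\mathfrak g$; 2. there are functions $\eta_1,\dots,\eta_c\in C^\infty(P)$ with $M=\{\eta_1=\dots=\eta_c=0\}$, whose differentials are linearly independent at every point of $M$, and vector fields $X_{\eta_i}\in\mathfrak X(P)$ with $i(X_{\eta_i})\omega=d\eta_i$; 3. the vector fields $X_{\eta_i}$ are tangent to $M$. Let $\mathcal J\colon M\to\mathfrak g^*$ be a momentum map and let $\mu\in\mathfrak g^*$. Then $\mathcal J$ extends to a $C^\infty$ map $\mathrm J\colon P\to\mathfrak g^*$ such that $$\mathcal J=\mathrm J\circ j_M\qquad\text{and}\qquad \mathrm J^{-1}(\mu)=j_M\bigl(\mathcal J^{-1}(\mu)\bigr).$$ -/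

import Mathlib

open scoped Manifold ContDiff Topology
open Bundle

noncomputable section

namespace Presymplectic

universe u

section Calculus

variable {E : Type*} [NormedAddCommGroup E] [NormedSpace ℝ E]
  {X : Type*} [TopologicalSpace X] [ChartedSpace E X]

/-- The differential at `p` of a real function, as a linear form on the tangent space. -/
def diff (f : X → ℝ) (p : X) : TangentSpace 𝓘(ℝ, E) p →L[ℝ] ℝ :=
  mfderiv 𝓘(ℝ, E) 𝓘(ℝ, ℝ) f p

/-- A family of tangent vectors `V` is a smooth vector field on `X`. -/
def IsSmoothField [IsManifold 𝓘(ℝ, E) ∞ X] (V : ∀ p : X, TangentSpace 𝓘(ℝ, E) p) : Prop :=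
  ContMDiff 𝓘(ℝ, E) 𝓘(ℝ, E).tangent ∞
    (fun p => (TotalSpace.mk' E p (V p) : TangentBundle 𝓘(ℝ, E) X))

/-- A family of bilinear forms on the tangent spaces is a smooth section of the bundle of
bilinear forms. -/
def IsSmoothBilin [IsManifold 𝓘(ℝ, E) ∞ X]
    (σ : ∀ p : X, TangentSpace 𝓘(ℝ, E) p →L[ℝ] TangentSpace 𝓘(ℝ, E) p →L[ℝ] ℝ) : Prop :=
  ContMDiff 𝓘(ℝ, E) (𝓘(ℝ, E).prod 𝓘(ℝ, E →L[ℝ] E →L[ℝ] ℝ)) ∞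
    (fun p => TotalSpace.mk' (E →L[ℝ] E →L[ℝ] ℝ)
      (E := fun p : X => TangentSpace 𝓘(ℝ, E) p →L[ℝ] TangentSpace 𝓘(ℝ, E) p →L[ℝ] ℝ) p (σ p))

/-- `dσ = 0`, where `dσ` is computed by the invariant formula
`dσ(U,V,W) = U σ(V,W) - V σ(U,W) + W σ(U,V) - σ([U,V],W) + σ([U,W],V) - σ([V,W],U)`. -/
def IsClosedTwoForm [IsManifold 𝓘(ℝ, E) ∞ X]
    (σ : ∀ p : X, TangentSpace 𝓘(ℝ, E) p →L[ℝ] TangentSpace 𝓘(ℝ, E) p →L[ℝ] ℝ) : Prop :=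
  ∀ U V W : ∀ p : X, TangentSpace 𝓘(ℝ, E) p,
    IsSmoothField U → IsSmoothField V → IsSmoothField W → ∀ p : X,
      diff (fun q => σ q (V q) (W q)) p (U p) - diff (fun q => σ q (U q) (W q)) p (V p)
        + diff (fun q => σ q (U q) (V q)) p (W p)
        - σ p (VectorField.mlieBracket 𝓘(ℝ, E) U V p) (W p)
        + σ p (VectorField.mlieBracket 𝓘(ℝ, E) U W p) (V p)
        - σ p (VectorField.mlieBracket 𝓘(ℝ, E) V W p) (U p) = 0

/-- A presymplectic form: a smooth closed 2-form which is degenerate and whose kernel has constant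
dimension. -/
structure IsPresymplectic [IsManifold 𝓘(ℝ, E) ∞ X]
    (σ : ∀ p : X, TangentSpace 𝓘(ℝ, E) p →L[ℝ] TangentSpace 𝓘(ℝ, E) p →L[ℝ] ℝ) : Prop where
  smooth : IsSmoothBilin σ
  alternating : ∀ (p : X) (v : TangentSpace 𝓘(ℝ, E) p), σ p v v = 0
  closed : IsClosedTwoForm σ
  degenerate_constantRank : ∃ r : ℕ, 0 < r ∧
    ∀ p : X, Module.finrank ℝ (LinearMap.ker (σ p).toLinearMap) = r

/-- `V` is a Hamiltonian vector field of the function `f`, that is, `i(V)σ = df`. -/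
structure IsHamiltonianField [IsManifold 𝓘(ℝ, E) ∞ X]
    (σ : ∀ p : X, TangentSpace 𝓘(ℝ, E) p →L[ℝ] TangentSpace 𝓘(ℝ, E) p →L[ℝ] ℝ)
    (V : ∀ p : X, TangentSpace 𝓘(ℝ, E) p) (f : X → ℝ) : Prop where
  smooth : IsSmoothField V
  eq : ∀ p : X, σ p (V p) = diff f p

/-- The Hamiltonian system `(X, σ, H)` is compatible: `i(V)σ = dH` has a solution `V` on all
of `X`. -/
def IsCompatible [IsManifold 𝓘(ℝ, E) ∞ X]
    (σ : ∀ p : X, TangentSpace 𝓘(ℝ, E) p →L[ℝ] TangentSpace 𝓘(ℝ, E) p →L[ℝ] ℝ)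
    (H : X → ℝ) : Prop :=
  ∃ V : ∀ p : X, TangentSpace 𝓘(ℝ, E) p, IsHamiltonianField σ V H

end Calculus

section Submanifold

variable {E : Type*} [NormedAddCommGroup E] [NormedSpace ℝ E]
  {P : Type*} [TopologicalSpace P] [ChartedSpace E P]
  {F : Type*} [NormedAddCommGroup F] [NormedSpace ℝ F]
  {M : Type*} [TopologicalSpace M] [ChartedSpace F M]

/-- The pull-back `j^*σ` of a 2-form. -/
def pullbackForm (j : M → P)
    (σ : ∀ p : P, TangentSpace 𝓘(ℝ, E) p →L[ℝ] TangentSpace 𝓘(ℝ, E) p →L[ℝ] ℝ) (x : M) :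
    TangentSpace 𝓘(ℝ, F) x →L[ℝ] TangentSpace 𝓘(ℝ, F) x →L[ℝ] ℝ :=
  (ContinuousLinearMap.precomp ℝ (mfderiv 𝓘(ℝ, F) 𝓘(ℝ, E) j x)).comp
    ((σ (j x)).comp (mfderiv 𝓘(ℝ, F) 𝓘(ℝ, E) j x))

/-- A vector field `V` on `P` is tangent to the submanifold `j : M → P`. -/
def IsTangentTo (j : M → P) (V : ∀ p : P, TangentSpace 𝓘(ℝ, E) p) : Prop :=
  ∀ x : M, ∃ v : TangentSpace 𝓘(ℝ, F) x, mfderiv 𝓘(ℝ, F) 𝓘(ℝ, E) j x v = V (j x)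

/-- `j : M → P` is a closed regular (that is, embedded) submanifold along which the equation
`i(V)σ = dH` has a solution `V` tangent to `M`. -/
structure IsSolutionSubmanifold [IsManifold 𝓘(ℝ, E) ∞ P]
    (σ : ∀ p : P, TangentSpace 𝓘(ℝ, E) p →L[ℝ] TangentSpace 𝓘(ℝ, E) p →L[ℝ] ℝ)
    (H : P → ℝ) (j : M → P) : Prop where
  embedding : Manifold.IsSmoothEmbedding 𝓘(ℝ, F) 𝓘(ℝ, E) ∞ j
  closed : IsClosed (Set.range j)
  solution : ∃ V : ∀ p : P, TangentSpace 𝓘(ℝ, E) p, IsSmoothField V ∧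
    IsTangentTo (F := F) j V ∧ ∀ x : M, σ (j x) (V (j x)) = diff H (j x)

end Submanifold

/-- `j : M → P` is the final constraint submanifold of `(P, σ, H)`: it is maximal among the
(connected) closed regular submanifolds along which `i(V)σ = dH` has a solution tangent to the
submanifold. -/
structure IsFinalConstraintSubmanifold
    {E : Type*} [NormedAddCommGroup E] [NormedSpace ℝ E]
    {P : Type u} [TopologicalSpace P] [ChartedSpace E P] [IsManifold 𝓘(ℝ, E) ∞ P]
    {F : Type*} [NormedAddCommGroup F] [NormedSpace ℝ F]
    {M : Type*} [TopologicalSpace M] [ChartedSpace F M]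
    (σ : ∀ p : P, TangentSpace 𝓘(ℝ, E) p →L[ℝ] TangentSpace 𝓘(ℝ, E) p →L[ℝ] ℝ)
    (H : P → ℝ) (j : M → P) : Prop where
  isSolution : IsSolutionSubmanifold (F := F) σ H j
  maximal : ∀ (d : ℕ) (N : Type u) [TopologicalSpace N]
    [ChartedSpace (EuclideanSpace ℝ (Fin d)) N]
    [IsManifold 𝓘(ℝ, EuclideanSpace ℝ (Fin d)) ∞ N] [ConnectedSpace N] (k : N → P),
    IsSolutionSubmanifold (F := EuclideanSpace ℝ (Fin d)) σ H k →
      Set.range j ⊆ Set.range k → Set.range k = Set.range j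

section Actions

variable {EG : Type*} [NormedAddCommGroup EG] [NormedSpace ℝ EG]
  {G : Type*} [TopologicalSpace G] [ChartedSpace EG G] [Group G]
  {F : Type*} [NormedAddCommGroup F] [NormedSpace ℝ F]
  {M : Type*} [TopologicalSpace M] [ChartedSpace F M] [MulAction G M]

/-- The fundamental vector field of `ξ` for the action of `G` on `M`: its value at `x` is the
image of `ξ` under the derivative at `1` of `g ↦ g • x`. -/
def fundamentalField (ξ : GroupLieAlgebra 𝓘(ℝ, EG) G) (x : M) : TangentSpace 𝓘(ℝ, F) x :=
  (mfderiv 𝓘(ℝ, EG) 𝓘(ℝ, F) (fun g : G => g • x) 1 ξ : TangentSpace 𝓘(ℝ, F) ((1 : G) • x))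

/-- `J : M → 𝔤*` is a momentum map for the action of `G` on `(M, Ω)`: it is smooth and
`i(ξ_M)Ω = d⟨J, ξ⟩` for every `ξ` in the Lie algebra. -/
structure IsMomentumMap
    (Ω : ∀ x : M, TangentSpace 𝓘(ℝ, F) x →L[ℝ] TangentSpace 𝓘(ℝ, F) x →L[ℝ] ℝ)
    (J : M → Module.Dual ℝ (GroupLieAlgebra 𝓘(ℝ, EG) G)) : Prop where
  smooth : ∀ ξ, ContMDiff 𝓘(ℝ, F) 𝓘(ℝ, ℝ) ∞ (fun x => J x ξ)
  eq : ∀ ξ x, Ω x (fundamentalField ξ x) = diff (fun y => J y ξ) x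

/-- The action of `G` on `(M, Ω)` is Poissonian: some momentum map has a comomentum map
`ξ ↦ f_ξ` which is a homomorphism of Lie algebras, that is, `f_[ξ,ζ] = {f_ξ, f_ζ}`, where
`{f_ξ, f_ζ} = Ω(ξ_M, ζ_M)`. -/
def IsPoissonian (EG : Type*) [NormedAddCommGroup EG] [NormedSpace ℝ EG]
    (G : Type*) [TopologicalSpace G] [ChartedSpace EG G] [Group G] [MulAction G M]
    (Ω : ∀ x : M, TangentSpace 𝓘(ℝ, F) x →L[ℝ] TangentSpace 𝓘(ℝ, F) x →L[ℝ] ℝ) : Prop :=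
  ∃ J : M → Module.Dual ℝ (GroupLieAlgebra 𝓘(ℝ, EG) G), IsMomentumMap Ω J ∧
    ∀ (ξ ζ : GroupLieAlgebra 𝓘(ℝ, EG) G) (x : M),
      J x ⁅ξ, ζ⁆ = Ω x (fundamentalField ξ x) (fundamentalField ζ x)

/-- Every vector field in the kernel of `Ω` is a combination, with smooth functions as
coefficients, of fundamental vector fields: `ker Ω ⊆ C^∞(M) ⊗ 𝔤_M`. -/
def KerInFundamental [IsManifold 𝓘(ℝ, F) ∞ M]
    (EG : Type*) [NormedAddCommGroup EG] [NormedSpace ℝ EG]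
    (G : Type*) [TopologicalSpace G] [ChartedSpace EG G] [Group G] [MulAction G M]
    (Ω : ∀ x : M, TangentSpace 𝓘(ℝ, F) x →L[ℝ] TangentSpace 𝓘(ℝ, F) x →L[ℝ] ℝ) : Prop :=
  ∀ Z : ∀ x : M, TangentSpace 𝓘(ℝ, F) x, IsSmoothField Z → (∀ x, Ω x (Z x) = 0) →
    ∃ (m : ℕ) (ξ : Fin m → GroupLieAlgebra 𝓘(ℝ, EG) G) (f : Fin m → M → ℝ),
      (∀ i, ContMDiff 𝓘(ℝ, F) 𝓘(ℝ, ℝ) ∞ (f i)) ∧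
        ∀ x, Z x = ∑ i, f i x • fundamentalField (ξ i) x

variable {E : Type*} [NormedAddCommGroup E] [NormedSpace ℝ E]
  {P : Type*} [TopologicalSpace P] [ChartedSpace E P]

/-- `G`, acting on `P`, is a symmetry group of `(P, σ, H)` with final constraint submanifold
`j : M → P`: the action leaves `M` invariant and induces the given action on `M`; the induced
action preserves `j^*σ` and `j^*H`, and it is Poissonian, free and proper. -/
structure IsSymmetryGroup
    (EG : Type*) [NormedAddCommGroup EG] [NormedSpace ℝ EG]
    (G : Type*) [TopologicalSpace G] [ChartedSpace EG G] [Group G] [MulAction G M] [MulAction G P]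
    (σ : ∀ p : P, TangentSpace 𝓘(ℝ, E) p →L[ℝ] TangentSpace 𝓘(ℝ, E) p →L[ℝ] ℝ)
    (H : P → ℝ) (j : M → P) : Prop where
  equivariant : ∀ (g : G) (x : M), j (g • x) = g • j x
  presymplectic : ∀ g : G,
    pullbackForm (F := F) (fun x : M => g • x) (pullbackForm (F := F) j σ)
      = pullbackForm (F := F) j σ
  poissonian : IsPoissonian EG G (pullbackForm (F := F) j σ)
  free : ∀ (g : G) (x : M), g • x = x → g = 1
  proper : ProperSMul G M
  hamiltonian : ∀ (g : G) (x : M), H (j (g • x)) = H (j x)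

end Actions

/-- The functions `η i` are a basis of constraint functions defining `j : M → P`: `M` is their
common zero set, and their differentials are linearly independent along `M`. -/
structure IsConstraintBasis
    {E : Type*} [NormedAddCommGroup E] [NormedSpace ℝ E]
    {P : Type*} [TopologicalSpace P] [ChartedSpace E P] {M : Type*}
    {c : ℕ} (j : M → P) (η : Fin c → P → ℝ) : Prop where
  smooth : ∀ i, ContMDiff 𝓘(ℝ, E) 𝓘(ℝ, ℝ) ∞ (η i)
  zeroSet : Set.range j = {p | ∀ i, η i p = 0}
  independent : ∀ x : M, LinearIndependent ℝ (fun i => diff (E := E) (η i) (j x))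

end Presymplectic

end

/-! Write `n = dim 𝔤` and let `F = 𝒥 - μ : M → ℝⁿ` in a basis of `𝔤`. The task is to extend `F` to
`P` so that every zero of the extension lies on `M`. With a retraction `r` onto `M`, smooth near
`M`, a cutoff `χ` equal to `1` on `M`, and a linear injection `L : ℝᶜ → ℝⁿ`, put `K = χ · (F ∘ r) +
L ∘ η`. On `M` this is `F`. At a zero of `K` with `χ = 0`, `L η = 0` forces `η = 0`; where `χ ≠ 0`,
the value `F (r p)` lies in the range of `L`. So it suffices that the range of `L` meets `F(M)` at
most in `0`: then `L η = 0` again, and the point is on `M`.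

Such an `L` exists because `F` has rank less than `n - c`. Indeed each `X_{η_i}` is tangent to `M`,
and its contraction with `ω` vanishes on `TM`, being `dη_i`; so it gives a section of `ker Ω`.
Degeneracy adds one more direction: a nonzero vector of `ker ω` extends, by constancy of the rank,
to a field `Y` in `ker ω`, tangent to `M` because `dη_i(Y) = ω(X_{η_i}, Y) = 0`. These `c + 1`
values are independent, and by the kernel hypothesis they are values of fundamental fields `ξ̃`, for
which `df_ξ = i(ξ̃)Ω = 0` at the given point
(`IsMomentumMap.exists_linearIndependent_diff_eq_zero`).

The passage from rank to `L` is Sard's theorem: the cone over the image of a map of rank less than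
`n - 1` is null (`volume_cone_eq_zero`), so some line meets the image at most in `0`. Projecting
along that line and iterating `c` times gives the subspace. The extra direction from `ker ω`
supplies exactly the one dimension that the cone costs. -/

namespace Presymplectic

open MeasureTheory Set Filter

/-! ### Straightening of functions, null images and flat points -/

/-- A smooth function with nonzero differential at `x₀` is a coordinate function near `x₀`. -/
theorem exists_straightening {m : ℕ} {U : Set (Fin (m + 1) → ℝ)} (hU : IsOpen U)
    {f : (Fin (m + 1) → ℝ) → ℝ} (hf : ContDiffOn ℝ ∞ f U) {x₀ : Fin (m + 1) → ℝ} (hx₀ : x₀ ∈ U)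
    (hd : fderiv ℝ f x₀ ≠ 0) :
    ∃ e : OpenPartialHomeomorph (Fin (m + 1) → ℝ) (ℝ × (Fin m → ℝ)), x₀ ∈ e.source ∧
      e.source ⊆ U ∧ ContDiffOn ℝ ∞ e e.source ∧ ContDiffOn ℝ ∞ e.symm e.target ∧
      ∀ x ∈ e.source, (e x).1 = f x := by
  obtain ⟨i, hi⟩ : ∃ i, fderiv ℝ f x₀ (Pi.single i 1) ≠ 0 := by
    by_contra! h
    apply hd
    ext v
    have hv : v = ∑ i, v i • (Pi.single i (1 : ℝ) : Fin (m + 1) → ℝ) := by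
      simpa using (pi_eq_sum_univ' v)
    rw [hv]
    simp [h]
  have hfat : ∀ x ∈ U, ContDiffAt ℝ ∞ f x := fun x hx => hf.contDiffAt (hU.mem_nhds hx)
  -- `R` forgets the coordinate `i` with `∂ᵢf ≠ 0`; `(f, R)` is then a local diffeomorphism.
  let R : (Fin (m + 1) → ℝ) →L[ℝ] (Fin m → ℝ) :=
    ContinuousLinearMap.pi fun k => ContinuousLinearMap.proj (i.succAbove k)
  let Ψ : (Fin (m + 1) → ℝ) → ℝ × (Fin m → ℝ) := fun x => (f x, R x)
  have hΨ : ∀ x ∈ U, ContDiffAt ℝ ∞ Ψ x := fun x hx => (hfat x hx).prodMk R.contDiff.contDiffAt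
  -- Restricting to all points with `∂ᵢf ≠ 0` makes the inverse smooth on the whole target, not only
  -- near the image of `x₀`.
  let U' : Set (Fin (m + 1) → ℝ) := {x | x ∈ U ∧ fderiv ℝ f x (Pi.single i 1) ≠ 0}
  have hU' : IsOpen U' := by
    have hc : ContinuousOn (fun x => fderiv ℝ f x (Pi.single i 1)) U :=
      (hf.continuousOn_fderiv_of_isOpen hU (by simp)).clm_apply continuousOn_const
    exact hc.isOpen_inter_preimage hU isOpen_ne
  have hinj : ∀ x ∈ U', Function.Injective ((fderiv ℝ f x).prod R) := by
    intro x hx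
    rw [injective_iff_map_eq_zero]
    intro v hv
    have h1 : fderiv ℝ f x v = 0 := congrArg Prod.fst hv
    have h2 : ∀ k, v (i.succAbove k) = 0 := fun k => congrFun (congrArg Prod.snd hv) k
    have h3 : v = v i • (Pi.single i (1 : ℝ) : Fin (m + 1) → ℝ) := by
      ext k
      rcases Fin.eq_self_or_eq_succAbove i k with rfl | ⟨l, rfl⟩
      · simp
      · simp [h2, Fin.succAbove_ne]
    rw [h3, map_smul, smul_eq_mul, mul_eq_zero] at h1
    rcases h1 with h1 | h1
    · rw [h3, h1, zero_smul]
    · exact absurd h1 hx.2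
  have hdim : Module.finrank ℝ (Fin (m + 1) → ℝ) = Module.finrank ℝ (ℝ × (Fin m → ℝ)) := by
    simp [add_comm]
  have hequiv : ∀ x ∈ U', ∃ L : (Fin (m + 1) → ℝ) ≃L[ℝ] ℝ × (Fin m → ℝ),
      HasFDerivAt Ψ (L : (Fin (m + 1) → ℝ) →L[ℝ] ℝ × (Fin m → ℝ)) x := by
    intro x hx
    refine ⟨(LinearEquiv.ofInjectiveOfFinrankEq
      ((fderiv ℝ f x).prod R).toLinearMap (hinj x hx) hdim).toContinuousLinearEquiv, ?_⟩
    have := (((hfat x hx.1).differentiableAt (by simp)).hasFDerivAt).prodMk (R.hasFDerivAt (x := x))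
    exact this.congr_fderiv rfl
  have hx₀' : x₀ ∈ U' := ⟨hx₀, hi⟩
  obtain ⟨L, hL⟩ := hequiv x₀ hx₀'
  let e₀ := (hΨ x₀ hx₀).toOpenPartialHomeomorph Ψ hL (by simp)
  have he₀ : (e₀ : (Fin (m + 1) → ℝ) → ℝ × (Fin m → ℝ)) = Ψ := rfl
  let e := e₀.restrOpen U' hU'
  have he : (e : (Fin (m + 1) → ℝ) → ℝ × (Fin m → ℝ)) = Ψ := rfl
  have hes : e.source ⊆ U' := fun x hx => by
    simp only [e, OpenPartialHomeomorph.restrOpen_source] at hx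
    exact hx.2
  refine ⟨e, ?_, fun x hx => (hes hx).1, ?_, ?_, fun x _ => rfl⟩
  · simp only [e, OpenPartialHomeomorph.restrOpen_source]
    exact ⟨(hΨ x₀ hx₀).mem_toOpenPartialHomeomorph_source hL (by simp), hx₀'⟩
  · intro x hx
    exact (hΨ x (hes hx).1).contDiffWithinAt
  · intro y hy
    have hx := hes (e.map_target hy)
    obtain ⟨L', hL'⟩ := hequiv _ hx
    exact (e.contDiffAt_symm hy hL' (hΨ _ hx.1)).contDiffWithinAt

/-- Lindelöf: countably many of the local neighbourhoods cover `s`, and a countable union of null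
sets is null. -/
theorem measure_image_null_of_locally_null {X Y : Type*} [TopologicalSpace X]
    [SecondCountableTopology X] [MeasurableSpace Y] {μ : Measure Y} {f : X → Y} {s : Set X}
    (h : ∀ x ∈ s, ∃ u ∈ 𝓝[s] x, μ (f '' u) = 0) : μ (f '' s) = 0 := by
  choose! u hu hμ using h
  obtain ⟨t, hts, htc, hst⟩ := TopologicalSpace.countable_cover_nhdsWithin hu
  refine measure_mono_null ((image_mono hst).trans (image_iUnion₂ f _).subset) ?_
  exact (measure_biUnion_null_iff htc).2 fun x hx => hμ x (hts hx)

/-- If all derivatives of order `k` with `1 ≤ k ≤ N` vanish on `C`, then locally `f` is Hölder of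
order `N + 1` on `C`. -/
theorem norm_iteratedFDeriv_le_pow {E : Type*} [NormedAddCommGroup E] [NormedSpace ℝ E]
    {F : Type*} [NormedAddCommGroup F] [NormedSpace ℝ F]
    {f : E → F} {B : Set E} (hB : Convex ℝ B) (hf : ∀ x ∈ B, ContDiffAt ℝ ∞ f x)
    {N : ℕ} {K : ℝ} (hK : 0 ≤ K) (hb : ∀ x ∈ B, ‖iteratedFDeriv ℝ (N + 1) f x‖ ≤ K)
    {x : E} (hx : x ∈ B) (hzero : ∀ k, 1 ≤ k → k ≤ N → iteratedFDeriv ℝ k f x = 0) :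
    ∀ y ∈ B, ‖f y - f x‖ ≤ K * ‖y - x‖ ^ (N + 1) := by
  have hseg : ∀ y ∈ B, ∀ z ∈ segment ℝ x y, z ∈ B ∧ ‖z - x‖ ≤ ‖y - x‖ := by
    intro y hy z hz
    refine ⟨hB.segment_subset hx hy hz, ?_⟩
    obtain ⟨t, ht, rfl⟩ := (segment_eq_image' ℝ x y ▸ hz :)
    simp only [add_sub_cancel_left, norm_smul, Real.norm_eq_abs]
    rw [abs_of_nonneg ht.1]
    exact mul_le_of_le_one_left (norm_nonneg _) ht.2
  have hdiff : ∀ k, ∀ z ∈ B, DifferentiableAt ℝ (iteratedFDeriv ℝ k f) z := fun k z hz =>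
    ((hf z hz).iteratedFDeriv_right (m := 1) (i := k) (by
      norm_cast; exact le_top)).differentiableAt (by simp)
  -- Descent from the top order: as each lower derivative vanishes at `x`, the mean value inequality
  -- on the segment from `x` gains one factor `‖y - x‖`.
  have main : ∀ j, j ≤ N → ∀ y ∈ B,
      ‖iteratedFDeriv ℝ (N + 1 - j) f y‖ ≤ K * ‖y - x‖ ^ j := by
    intro j
    induction j with
    | zero => intro _ y hy; simpa using hb y hy
    | succ j ih =>
      intro hj y hy
      have hk : N + 1 - j = (N + 1 - (j + 1)) + 1 := by omega
      have := (convex_segment x y).norm_image_sub_le_of_norm_fderiv_le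
        (f := iteratedFDeriv ℝ (N + 1 - (j + 1)) f) (C := K * ‖y - x‖ ^ j)
        (fun z hz => hdiff _ z (hseg y hy z hz).1)
        (fun z hz => by
          rw [norm_fderiv_iteratedFDeriv, ← hk]
          refine (ih (by omega) z (hseg y hy z hz).1).trans ?_
          have := (hseg y hy z hz).2
          gcongr) (left_mem_segment ℝ x y) (right_mem_segment ℝ x y)
      rw [hzero _ (by omega) (by omega), sub_zero] at this
      rw [pow_succ, ← mul_assoc]
      exact this
  -- Order zero is separate because `f x` itself need not vanish; only the difference is bounded.
  intro y hy
  have := (convex_segment x y).norm_image_sub_le_of_norm_fderiv_le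
    (f := f) (C := K * ‖y - x‖ ^ N)
    (fun z hz => (hf z (hseg y hy z hz).1).differentiableAt (by simp))
    (fun z hz => by
      have h1 := main N le_rfl z (hseg y hy z hz).1
      rw [Nat.add_sub_cancel_left, norm_iteratedFDeriv_one] at h1
      refine h1.trans ?_
      have := (hseg y hy z hz).2
      gcongr) (left_mem_segment ℝ x y) (right_mem_segment ℝ x y)
  rw [pow_succ, ← mul_assoc]
  exact this

/-- The image of the set of points where a smooth real function on `ℝᵐ` is flat to order `m` is a
null set. -/
theorem volume_image_flat_eq_zero {m : ℕ} {U : Set (Fin m → ℝ)} (hU : IsOpen U)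
    {f : (Fin m → ℝ) → ℝ} (hf : ContDiffOn ℝ ∞ f U) :
    volume (f '' {x | x ∈ U ∧ ∀ k, 1 ≤ k → k ≤ m → iteratedFDeriv ℝ k f x = 0}) = 0 := by
  refine measure_image_null_of_locally_null fun x₀ hx₀ => ?_
  have hfat : ∀ x ∈ U, ContDiffAt ℝ ∞ f x := fun x hx => hf.contDiffAt (hU.mem_nhds hx)
  have hcont : ContinuousAt (iteratedFDeriv ℝ (m + 1) f) x₀ :=
    ((hfat x₀ hx₀.1).iteratedFDeriv_right (m := 1) (i := m + 1) (by
      norm_cast; exact le_top)).continuousAt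
  set K : ℝ := ‖iteratedFDeriv ℝ (m + 1) f x₀‖ + 1 with hKdef
  have hK : 0 ≤ K := by positivity
  have hev : ∀ᶠ x in 𝓝 x₀, x ∈ U ∧ ‖iteratedFDeriv ℝ (m + 1) f x‖ ≤ K := by
    refine Filter.Eventually.and (hU.mem_nhds hx₀.1) ?_
    exact (hcont.norm.eventually_lt continuousAt_const (lt_add_one _)).mono fun _ h => h.le
  obtain ⟨ε, hε, hball⟩ := Metric.eventually_nhds_iff_ball.1 hev
  set S := {x | x ∈ U ∧ ∀ k, 1 ≤ k → k ≤ m → iteratedFDeriv ℝ k f x = 0}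
  refine ⟨Metric.ball x₀ ε ∩ S, inter_mem
    (mem_nhdsWithin_of_mem_nhds (Metric.ball_mem_nhds x₀ hε)) self_mem_nhdsWithin, ?_⟩
  -- Exponent `m + 1` on a set of dimension at most `m` bounds the dimension of the image by `m / (m
  -- + 1) < 1`, so its length is zero.
  have hH : HolderOnWith K.toNNReal (m + 1 : ℕ) f (Metric.ball x₀ ε ∩ S) := by
    rw [HolderOnWith]
    intro y hy x hx
    have := norm_iteratedFDeriv_le_pow (convex_ball x₀ ε) (fun z hz => hfat z (hball z hz).1) hK
      (fun z hz => (hball z hz).2) hx.1 hx.2.2 y hy.1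
    rw [edist_dist, edist_dist, dist_eq_norm, dist_eq_norm]
    rw [NNReal.coe_natCast, ENNReal.rpow_natCast, ← ENNReal.ofReal_pow (norm_nonneg _)]
    change _ ≤ ENNReal.ofReal K * _
    rw [← ENNReal.ofReal_mul hK]
    exact ENNReal.ofReal_le_ofReal this
  have hdim := hH.dimH_image_le (by positivity)
  have h1 : dimH (f '' (Metric.ball x₀ ε ∩ S)) < ((1 : NNReal) : ENNReal) := by
    refine hdim.trans_lt ?_
    have h2 : dimH (Metric.ball x₀ ε ∩ S) ≤ m := by
      refine (dimH_mono (subset_univ _)).trans ?_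
      rw [Real.dimH_univ_pi_fin]
    refine (ENNReal.div_le_div_right h2 _).trans_lt ?_
    rw [ENNReal.div_lt_iff (by simp) (by simp)]
    simp only [ENNReal.coe_one, one_mul]
    norm_cast
    omega
  have := hausdorffMeasure_of_dimH_lt h1
  rw [← hausdorffMeasure_real]
  simpa using this

end Presymplectic

/-! ### Sard's theorem, for functions and for nowhere submersive maps -/

namespace Presymplectic

open MeasureTheory Set Filter

/-- The Morse–Sard theorem for real functions on `ℝᵐ`. -/
theorem volume_image_fderiv_eq_zero (m : ℕ) : ∀ {U : Set (Fin m → ℝ)} (_ : IsOpen U)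
    {f : (Fin m → ℝ) → ℝ} (_ : ContDiffOn ℝ ∞ f U),
    volume (f '' {x | x ∈ U ∧ fderiv ℝ f x = 0}) = 0 := by
  induction m with
  | zero =>
    intro U _ f _
    exact (Set.subsingleton_of_subsingleton.image f).measure_zero _
  | succ m ih =>
    intro U hU f hf
    have hfat : ∀ x ∈ U, ContDiffAt ℝ ∞ f x := fun x hx => hf.contDiffAt (hU.mem_nhds hx)
    -- A critical point is flat to order `m + 1` or has a first nonvanishing derivative, of some
    -- order `l + 1 ≥ 2`. Keeping `fderiv ℝ f x = 0` in `T l` lets the induction treat its points as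
    -- critical points of a restriction of `f`.
    set T : ℕ → Set (Fin (m + 1) → ℝ) := fun l =>
      {x | x ∈ U ∧ fderiv ℝ f x = 0 ∧ iteratedFDeriv ℝ l f x = 0 ∧
        iteratedFDeriv ℝ (l + 1) f x ≠ 0} with hT
    have hsub : {x | x ∈ U ∧ fderiv ℝ f x = 0} ⊆
        {x | x ∈ U ∧ ∀ k, 1 ≤ k → k ≤ m + 1 → iteratedFDeriv ℝ k f x = 0} ∪ ⋃ l, T l := by
      rintro x ⟨hxU, hx⟩
      by_cases h : ∀ k, 1 ≤ k → iteratedFDeriv ℝ k f x = 0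
      · exact Or.inl ⟨hxU, fun k hk _ => h k hk⟩
      · right
        push Not at h
        classical
        have hspec := Nat.find_spec h
        have hmin := fun k => Nat.find_min (m := k) h
        set k := Nat.find h
        have h1 : k ≠ 1 := by
          intro h1
          apply hspec.2
          rw [← norm_eq_zero, h1, norm_iteratedFDeriv_one, hx, norm_zero]
        obtain ⟨l, hl⟩ : ∃ l, k = l + 1 := ⟨k - 1, by omega⟩
        refine mem_iUnion.2 ⟨l, hxU, hx, ?_, ?_⟩
        · by_contra hne
          exact hmin l (by omega) ⟨by omega, hne⟩
        · rw [← hl]; exact hspec.2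
    refine measure_mono_null (image_mono hsub) ?_
    rw [image_union, image_iUnion]
    refine measure_union_null (volume_image_flat_eq_zero hU hf) (measure_iUnion_null fun l => ?_)
    refine measure_image_null_of_locally_null fun x₀ hx₀ => ?_
    have hDl : ∀ x ∈ U, ContDiffAt ℝ ∞ (iteratedFDeriv ℝ l f) x := fun x hx =>
      (hfat x hx).iteratedFDeriv_right (by norm_cast)
    have hne : fderiv ℝ (iteratedFDeriv ℝ l f) x₀ ≠ 0 := by
      intro h
      apply hx₀.2.2.2
      rw [← norm_eq_zero, ← norm_fderiv_iteratedFDeriv, h]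
      exact ContinuousLinearMap.opNorm_zero
    obtain ⟨w, hw⟩ : ∃ w, fderiv ℝ (iteratedFDeriv ℝ l f) x₀ w ≠ 0 := by
      by_contra! h
      exact hne (ContinuousLinearMap.ext h)
    obtain ⟨v, hv⟩ : ∃ v, fderiv ℝ (iteratedFDeriv ℝ l f) x₀ w v ≠ 0 := by
      by_contra! h
      exact hw (ContinuousMultilinearMap.ext h)
    -- The `l`-th derivative evaluated at `v` vanishes on `T l` and has nonzero differential at
    -- `x₀`: near `x₀`, `T l` lies in a hypersurface.
    let A := ContinuousMultilinearMap.apply ℝ (fun _ : Fin l => Fin (m + 1) → ℝ) ℝ v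
    have hA : ContDiffOn ℝ ∞ (fun x => A (iteratedFDeriv ℝ l f x)) U := fun x hx =>
      (A.contDiff.contDiffAt.comp x (hDl x hx)).contDiffWithinAt
    have hAd : fderiv ℝ (fun x => A (iteratedFDeriv ℝ l f x)) x₀ ≠ 0 := by
      have h1 : HasFDerivAt (fun x => A (iteratedFDeriv ℝ l f x))
          (A.comp (fderiv ℝ (iteratedFDeriv ℝ l f) x₀)) x₀ :=
        A.hasFDerivAt.comp x₀ ((hDl x₀ hx₀.1).differentiableAt (by simp)).hasFDerivAt
      rw [h1.fderiv]
      intro h0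
      exact hv (congrArg (fun L => L w) h0)
    obtain ⟨e, hxe, heU, -, hes, hfst⟩ := exists_straightening hU hA hx₀.1 hAd
    refine ⟨e.source ∩ T l, inter_mem
      (mem_nhdsWithin_of_mem_nhds (e.open_source.mem_nhds hxe)) self_mem_nhdsWithin, ?_⟩
    -- The hypersurface in straightened coordinates. Critical points of `f` on it remain critical
    -- for the restriction, so dimension `m` applies.
    let ι : (Fin m → ℝ) → ℝ × (Fin m → ℝ) := fun w => (0, w)
    have hι : ContDiff ℝ ∞ ι := contDiff_const.prodMk contDiff_id
    have hW : IsOpen (ι ⁻¹' e.target) := e.open_target.preimage hι.continuous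
    have hg : ContDiffOn ℝ ∞ (fun w => f (e.symm (ι w))) (ι ⁻¹' e.target) :=
      hf.comp (hes.comp hι.contDiffOn fun w hw => hw) fun w hw => heU (e.map_target hw)
    refine measure_mono_null ?_ (ih hW hg)
    rintro _ ⟨x, ⟨hxs, hxU, hx0, hxl, -⟩, rfl⟩
    have hex : ι (e x).2 = e x := by
      refine Prod.ext ?_ rfl
      rw [hfst x hxs, hxl]
      simp [ι]
    have hsymm : e.symm (ι (e x).2) = x := by rw [hex, e.left_inv hxs]
    have hmem : ι (e x).2 ∈ e.target := by rw [hex]; exact e.map_source hxs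
    refine ⟨(e x).2, ⟨hmem, ?_⟩, by simp only [hsymm]⟩
    have h1 : HasFDerivAt f (0 : (Fin (m + 1) → ℝ) →L[ℝ] ℝ) (e.symm (ι (e x).2)) := by
      rw [hsymm, ← hx0]
      exact ((hfat x hxU).differentiableAt (by simp)).hasFDerivAt
    have h2 : DifferentiableAt ℝ (fun w => e.symm (ι w)) (e x).2 :=
      (((hes.contDiffAt (e.open_target.mem_nhds hmem)).comp (e x).2
        hι.contDiffAt).differentiableAt (by simp))
    have h3 := (h1.comp (e x).2 h2.hasFDerivAt).fderiv
    rw [ContinuousLinearMap.zero_comp] at h3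
    exact h3

/-- The image of a smooth map `ℝᵐ → ℝⁿ` whose differential is nowhere surjective is a null set. -/
theorem volume_image_eq_zero_of_not_surjective (n : ℕ) : ∀ {m : ℕ} {U : Set (Fin m → ℝ)}
    (_ : IsOpen U) {f : (Fin m → ℝ) → (Fin n → ℝ)} (_ : ContDiffOn ℝ ∞ f U)
    (_ : ∀ x ∈ U, ¬ Function.Surjective (fderiv ℝ f x)), volume (f '' U) = 0 := by
  induction n with
  | zero =>
    intro m U hU f hf hs
    have : U = ∅ := eq_empty_of_forall_notMem fun x hx =>
      hs x hx (Function.surjective_to_subsingleton _)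
    simp [this]
  | succ n ih =>
    intro m U hU f hf hs
    have hfat : ∀ x ∈ U, ContDiffAt ℝ ∞ f x := fun x hx => hf.contDiffAt (hU.mem_nhds hx)
    have hfi : ∀ i, ContDiffOn ℝ ∞ (fun x => f x i) U := fun i => contDiffOn_pi.1 hf i
    have hfd : ∀ x ∈ U, ∀ i, HasFDerivAt (fun x => f x i)
        ((ContinuousLinearMap.proj i).comp (fderiv ℝ f x)) x := fun x hx i =>
      (ContinuousLinearMap.proj (R := ℝ) (φ := fun _ : Fin (n + 1) => ℝ) i).hasFDerivAt.comp x
        ((hfat x hx).differentiableAt (by simp)).hasFDerivAt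
    have hsub : U ⊆ {x | x ∈ U ∧ fderiv ℝ f x = 0} ∪ {x | x ∈ U ∧ fderiv ℝ f x ≠ 0} := fun x hx =>
      (em (fderiv ℝ f x = 0)).imp (fun h => ⟨hx, h⟩) fun h => ⟨hx, h⟩
    refine measure_mono_null (image_mono hsub) ?_
    rw [image_union]
    refine measure_union_null ?_ ?_
    -- Where the whole differential vanishes, component `0` is critical, so the image lies over a
    -- null set of that coordinate.
    · have h0 := volume_image_fderiv_eq_zero m hU (hfi 0)
      have := (Measure.quasiMeasurePreserving_eval (fun _ : Fin (n + 1) => (volume : Measure ℝ))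
        0).preimage_null h0
      refine measure_mono_null ?_ this
      rintro _ ⟨x, ⟨hxU, hx⟩, rfl⟩
      refine ⟨x, ⟨hxU, ?_⟩, rfl⟩
      rw [(hfd x hxU 0).fderiv, hx, ContinuousLinearMap.comp_zero]
    · refine measure_image_null_of_locally_null fun x₀ hx₀ => ?_
      obtain ⟨hx₀U, hx₀d⟩ := hx₀
      obtain ⟨i, hi⟩ : ∃ i, fderiv ℝ (fun x => f x i) x₀ ≠ 0 := by
        by_contra! h
        refine hx₀d (ContinuousLinearMap.ext fun v => funext fun i => ?_)
        have := h i
        rw [(hfd x₀ hx₀U i).fderiv] at this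
        exact congrArg (fun L => L v) this
      cases m with
      | zero =>
        exact absurd (ContinuousLinearMap.ext fun v => by
          rw [Subsingleton.elim v 0, map_zero, map_zero]) hx₀d
      | succ m =>
      obtain ⟨e, hxe, heU, -, hes, hfst⟩ := exists_straightening hU (hfi i) hx₀U hi
      -- Compactness makes the image closed, hence measurable, as the null criterion for product
      -- measures requires.
      obtain ⟨K, hK, hKe, hKc⟩ := local_compact_nhds (e.open_source.mem_nhds hxe)
      refine ⟨K, mem_nhdsWithin_of_mem_nhds hK, ?_⟩
      have hcK : IsCompact (f '' K) := hKc.image_of_continuousOn (hf.continuousOn.mono (hKe.trans heU))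
      set Φ := MeasurableEquiv.piFinSuccAbove (fun _ : Fin (n + 1) => ℝ) i
      have hΦ := volume_preserving_piFinSuccAbove (fun _ : Fin (n + 1) => ℝ) i
      have hmeas : MeasurableSet (Φ '' (f '' K)) :=
        (MeasurableEquiv.measurableSet_image Φ).2 hcK.isClosed.measurableSet
      have hpre : f '' K = Φ ⁻¹' (Φ '' (f '' K)) := by
        rw [Φ.injective.preimage_image]
      rw [hpre, hΦ.measure_preimage_equiv]
      -- Fubini over the value `s` of component `i`: each section lies in the image of the slice
      -- `f_i = s` under the other components.
      refine (Measure.measure_prod_null hmeas).2 (Eventually.of_forall fun s => ?_)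
      let ι : (Fin m → ℝ) → ℝ × (Fin m → ℝ) := fun w => (s, w)
      have hι : ContDiff ℝ ∞ ι := contDiff_const.prodMk contDiff_id
      have hW : IsOpen (ι ⁻¹' e.target) := e.open_target.preimage hι.continuous
      let R : (Fin (n + 1) → ℝ) →L[ℝ] (Fin n → ℝ) :=
        ContinuousLinearMap.pi fun k => ContinuousLinearMap.proj (i.succAbove k)
      have hfe : ContDiffOn ℝ ∞ (fun z => f (e.symm z)) e.target :=
        hf.comp hes fun z hz => heU (e.map_target hz)
      have hg : ContDiffOn ℝ ∞ (fun w => R (f (e.symm (ι w)))) (ι ⁻¹' e.target) :=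
        R.contDiff.comp_contDiffOn (hfe.comp hι.contDiffOn fun w hw => hw)
      refine measure_mono_null ?_ (ih hW hg ?_)
      · rintro y ⟨_, ⟨x, hxK, rfl⟩, hxy⟩
        have hxs := hKe hxK
        have h1 : f x i = s := congrArg Prod.fst hxy
        have h2 : R (f x) = y := congrArg Prod.snd hxy
        have hex : ι (e x).2 = e x := Prod.ext (by rw [hfst x hxs, h1]) rfl
        refine ⟨(e x).2, ?_, ?_⟩
        · change ι (e x).2 ∈ e.target
          rw [hex]; exact e.map_source hxs
        · simp only [hex, e.left_inv hxs, h2]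
      · intro w hw hsurj
        have hx : e.symm (ι w) ∈ U := heU (e.map_target hw)
        have hsd : DifferentiableAt ℝ e.symm (ι w) :=
          (hes.contDiffAt (e.open_target.mem_nhds hw)).differentiableAt (by simp)
        have hd : HasFDerivAt (fun z => f (e.symm z))
            ((fderiv ℝ f (e.symm (ι w))).comp (fderiv ℝ e.symm (ι w))) (ι w) :=
          (((hfat _ hx).differentiableAt (by simp)).hasFDerivAt).comp _ hsd.hasFDerivAt
        set D := (fderiv ℝ f (e.symm (ι w))).comp (fderiv ℝ e.symm (ι w))
        have hDi : ∀ z, D z i = z.1 := by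
          have h1 : HasFDerivAt (fun z => f (e.symm z) i)
              ((ContinuousLinearMap.proj i).comp D) (ι w) :=
            (ContinuousLinearMap.proj (R := ℝ) (φ := fun _ : Fin (n + 1) => ℝ) i).hasFDerivAt.comp
              (ι w) hd
          have h2 : HasFDerivAt (fun z => f (e.symm z) i)
              (ContinuousLinearMap.fst ℝ ℝ (Fin m → ℝ)) (ι w) := by
            refine (ContinuousLinearMap.fst ℝ ℝ (Fin m → ℝ)).hasFDerivAt.congr_of_eventuallyEq ?_
            filter_upwards [e.open_target.mem_nhds hw] with z hz
            rw [← hfst _ (e.map_target hz), e.right_inv hz]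
            rfl
          intro z
          exact congrArg (fun L => L z) (h1.unique h2)
        have hgd : HasFDerivAt (fun w => R (f (e.symm (ι w))))
            (R.comp (D.comp (ContinuousLinearMap.inr ℝ ℝ (Fin m → ℝ)))) w := by
          refine R.hasFDerivAt.comp w (hd.comp w ?_)
          exact (hasFDerivAt_const s w).prodMk (hasFDerivAt_id w)
        rw [hgd.fderiv] at hsurj
        -- In straightened coordinates component `i` of `D` is the first variable. Surjectivity on
        -- the slice would give surjectivity of `D`: take first entry `y i`, then correct the other
        -- components by `u`.
        refine hs _ hx fun y => ?_
        obtain ⟨u, hu⟩ := hsurj (R (y - D (y i, 0)))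
        have hDs : D (y i, u) = y := by
          have hsplit : D (y i, u) = D (y i, 0) + D (0, u) := by
            rw [← map_add]; simp
          ext k
          rcases Fin.eq_self_or_eq_succAbove i k with rfl | ⟨l, rfl⟩
          · exact hDi _
          · have := congrFun hu l
            have h3 : D (0, u) (i.succAbove l) = (y - D (y i, 0)) (i.succAbove l) := this
            rw [hsplit, Pi.add_apply, h3]
            simp
        exact ⟨_, hDs⟩

end Presymplectic

/-! ### Linear subspaces avoiding the image of a map of small rank -/

namespace Presymplectic

open MeasureTheory Set Filter

theorem volume_image_eq_zero_of_not_surjective' {E : Type*} [NormedAddCommGroup E]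
    [NormedSpace ℝ E] [FiniteDimensional ℝ E] {n : ℕ} {U : Set E} (hU : IsOpen U)
    {f : E → (Fin n → ℝ)} (hf : ContDiffOn ℝ ∞ f U)
    (hs : ∀ x ∈ U, ¬ Function.Surjective (fderiv ℝ f x)) : volume (f '' U) = 0 := by
  let e : E ≃L[ℝ] (Fin (Module.finrank ℝ E) → ℝ) := (Module.finBasis ℝ E).equivFunL
  have hU' : IsOpen (e.symm ⁻¹' U) := hU.preimage e.symm.continuous
  have h := volume_image_eq_zero_of_not_surjective n hU' (f := fun y => f (e.symm y))
    (hf.comp e.symm.contDiff.contDiffOn fun y hy => hy) ?_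
  · refine measure_mono_null ?_ h
    rintro _ ⟨x, hx, rfl⟩
    exact ⟨e x, by simpa using hx, by simp⟩
  · intro y hy hsurj
    have h1 : HasFDerivAt (fun y => f (e.symm y))
        ((fderiv ℝ f (e.symm y)).comp (e.symm : _ →L[ℝ] E)) y :=
      ((hf.contDiffAt (hU.mem_nhds hy)).differentiableAt (by simp)).hasFDerivAt.comp y
        e.symm.hasFDerivAt
    rw [h1.fderiv] at hsurj
    exact hs _ hy (Function.Surjective.of_comp hsurj)

variable {EM : Type*} [NormedAddCommGroup EM] [NormedSpace ℝ EM]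
  {M : Type*} [TopologicalSpace M] [ChartedSpace EM M]

/-- The cone over the image of a smooth map to `ℝⁿ` of rank less than `n - 1` is a null set. -/
theorem volume_cone_eq_zero [FiniteDimensional ℝ EM] [IsManifold 𝓘(ℝ, EM) ∞ M]
    [SecondCountableTopology M] {n : ℕ} {F : M → (Fin n → ℝ)}
    (hF : ContMDiff 𝓘(ℝ, EM) 𝓘(ℝ, Fin n → ℝ) ∞ F)
    (hrank : ∀ x, ∃ W : Submodule ℝ (Fin n → ℝ), Module.finrank ℝ W + 1 < n ∧
      ∀ v, mfderiv 𝓘(ℝ, EM) 𝓘(ℝ, Fin n → ℝ) F x v ∈ W) :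
    volume ((fun z : ℝ × M => z.1 • F z.2) '' univ) = 0 := by
  refine measure_image_null_of_locally_null fun z _ => ?_
  set φ := extChartAt 𝓘(ℝ, EM) z.2
  have hφo : IsOpen φ.target := isOpen_extChartAt_target z.2
  refine ⟨univ ×ˢ φ.source, mem_nhdsWithin_of_mem_nhds
    (prod_mem_nhds univ_mem (extChartAt_source_mem_nhds z.2)), ?_⟩
  have hsymm : ContMDiffOn 𝓘(ℝ, EM) 𝓘(ℝ, EM) ∞ φ.symm φ.target := contMDiffOn_extChartAt_symm z.2
  have hG : ContDiffOn ℝ ∞ (fun v => F (φ.symm v)) φ.target :=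
    (hF.comp_contMDiffOn hsymm).contDiffOn
  have hU : IsOpen ((univ : Set ℝ) ×ˢ φ.target) := isOpen_univ.prod hφo
  have hf : ContDiffOn ℝ ∞ (fun w : ℝ × EM => w.1 • F (φ.symm w.2)) (univ ×ˢ φ.target) :=
    contDiff_fst.contDiffOn.smul (hG.comp contDiff_snd.contDiffOn fun w hw => hw.2)
  refine measure_mono_null ?_ (volume_image_eq_zero_of_not_surjective' hU hf ?_)
  · rintro _ ⟨w, ⟨-, hw⟩, rfl⟩
    exact ⟨(w.1, φ w.2), ⟨mem_univ _, φ.map_source hw⟩, by simp only [φ.left_inv hw]⟩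
  · rintro ⟨s, v⟩ ⟨-, hv⟩ hsurj
    obtain ⟨W, hW, hFW⟩ := hrank (φ.symm v)
    have hD : HasFDerivAt (fun v => F (φ.symm v)) (fderiv ℝ (fun v => F (φ.symm v)) v) v :=
      ((hG.contDiffAt (hφo.mem_nhds hv)).differentiableAt (by simp)).hasFDerivAt
    have hDW : ∀ u, fderiv ℝ (fun v => F (φ.symm v)) v u ∈ W := by
      intro u
      have h1 : MDifferentiableAt 𝓘(ℝ, EM) 𝓘(ℝ, EM) φ.symm v :=
        (hsymm.contMDiffAt (hφo.mem_nhds hv)).mdifferentiableAt (by simp)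
      have h2 : MDifferentiableAt 𝓘(ℝ, EM) 𝓘(ℝ, Fin n → ℝ) F (φ.symm v) :=
        (hF _).mdifferentiableAt (by simp)
      have h3 := mfderiv_comp v h2 h1
      rw [mfderiv_eq_fderiv] at h3
      have h4 : fderiv ℝ (fun v => F (φ.symm v)) v u = mfderiv 𝓘(ℝ, EM) 𝓘(ℝ, Fin n → ℝ) F
        (φ.symm v) (mfderiv 𝓘(ℝ, EM) 𝓘(ℝ, EM) φ.symm v u) := congrArg (fun L => L u) h3
      rw [h4]
      exact hFW _
    have hd := (hasFDerivAt_fst (𝕜 := ℝ) (p := (s, v))).smul (hD.comp (s, v) hasFDerivAt_snd)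
    have hd' : fderiv ℝ (fun w : ℝ × EM => w.1 • F (φ.symm w.2)) (s, v) = _ := hd.fderiv
    -- The differential of `s • F` is `s dF + ds F`, with values in `W` plus one line, of dimension
    -- at most `finrank W + 1 < n`.
    have htop : (⊤ : Submodule ℝ (Fin n → ℝ)) ≤ W ⊔ Submodule.span ℝ {F (φ.symm v)} := by
      intro y _
      obtain ⟨u, hu⟩ := hsurj y
      rw [hd'] at hu
      rw [← hu]
      refine Submodule.add_mem_sup (W.smul_mem _ (hDW _)) ?_
      exact Submodule.smul_mem _ _ (Submodule.mem_span_singleton_self _)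
    have h1 := Submodule.finrank_mono htop
    have h2 := Submodule.finrank_add_le_finrank_add_finrank W (Submodule.span ℝ {F (φ.symm v)})
    have h3 : Module.finrank ℝ (Submodule.span ℝ {F (φ.symm v)}) ≤ 1 :=
      (finrank_span_le_card _).trans (by simp)
    rw [finrank_top, Module.finrank_fin_fun] at h1
    omega

/-- If a smooth map to `ℝⁿ` has rank less than `n - c`, then a generic linear subspace of
dimension `c` meets its image at most at the origin. -/
theorem exists_surjective_forall_eq_zero [FiniteDimensional ℝ EM] [IsManifold 𝓘(ℝ, EM) ∞ M]
    [SecondCountableTopology M] [Nonempty M] {n : ℕ} {F : M → (Fin n → ℝ)}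
    (hF : ContMDiff 𝓘(ℝ, EM) 𝓘(ℝ, Fin n → ℝ) ∞ F) (c : ℕ)
    (hrank : ∀ x, ∃ W : Submodule ℝ (Fin n → ℝ), Module.finrank ℝ W + c < n ∧
      ∀ v, mfderiv 𝓘(ℝ, EM) 𝓘(ℝ, Fin n → ℝ) F x v ∈ W) :
    ∃ Q : (Fin n → ℝ) →L[ℝ] (Fin (n - c) → ℝ), Function.Surjective Q ∧
      ∀ x, Q (F x) = 0 → F x = 0 := by
  induction c with
  | zero => exact ⟨ContinuousLinearMap.id ℝ _, Function.surjective_id, fun x h => h⟩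
  | succ c ih =>
    obtain ⟨Q, hQ, hQF⟩ := ih fun x => by
      obtain ⟨W, h1, h2⟩ := hrank x
      exact ⟨W, by omega, h2⟩
    -- A point of `M` is needed to get `c + 1 < n`, which makes the truncated subtraction `n - (c +
    -- 1)` genuine.
    obtain ⟨x₀⟩ := ‹Nonempty M›
    have hcn : c + 1 < n := by
      obtain ⟨W, h1, -⟩ := hrank x₀
      omega
    have hcone := volume_cone_eq_zero (F := fun x => Q (F x))
      (Q.contDiff.contMDiff.comp hF) fun x => by
        obtain ⟨W, h1, h2⟩ := hrank x
        refine ⟨W.map Q.toLinearMap, ?_, fun v => ?_⟩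
        · have := Submodule.finrank_map_le Q.toLinearMap W
          omega
        · have h3 := mfderiv_comp x Q.differentiableAt.mdifferentiableAt
            ((hF x).mdifferentiableAt (by simp))
          rw [mfderiv_eq_fderiv, Q.fderiv] at h3
          have h4 : mfderiv 𝓘(ℝ, EM) 𝓘(ℝ, Fin (n - c) → ℝ) (fun x => Q (F x)) x v =
            Q (mfderiv 𝓘(ℝ, EM) 𝓘(ℝ, Fin n → ℝ) F x v) := congrArg (fun L => L v) h3
          rw [h4]
          exact ⟨_, h2 v, rfl⟩
    have huniv : ((fun z : ℝ × M => z.1 • Q (F z.2)) '' univ) ≠ univ := by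
      intro h
      rw [h] at hcone
      exact (NeZero.ne (volume : Measure (Fin (n - c) → ℝ))) (Measure.measure_univ_eq_zero.1 hcone)
    -- A vector outside the null cone: a nonzero `Q (F x)` on the line `ℝ e` could be rescaled to
    -- `e`. Dividing by this line enlarges the kernel of `Q` by one dimension.
    obtain ⟨e, he⟩ := (ne_univ_iff_exists_notMem _).1 huniv
    have he' : ∀ (s : ℝ) x, s • Q (F x) ≠ e := fun s x h => he ⟨(s, x), mem_univ _, h⟩
    have he0 : e ≠ 0 := fun h => he' 0 x₀ (by rw [h, zero_smul])
    have hfin : Module.finrank ℝ ((Fin (n - c) → ℝ) ⧸ Submodule.span ℝ {e}) =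
        Module.finrank ℝ (Fin (n - (c + 1)) → ℝ) := by
      have := Submodule.finrank_quotient_add_finrank (Submodule.span ℝ {e})
      rw [finrank_span_singleton he0, Module.finrank_fin_fun] at this
      rw [Module.finrank_fin_fun]
      omega
    let T := (LinearEquiv.ofFinrankEq _ _ hfin).toLinearMap ∘ₗ (Submodule.span ℝ {e}).mkQ
    refine ⟨(LinearMap.toContinuousLinearMap T).comp Q, ?_, fun x hx => hQF x ?_⟩
    · exact ((LinearEquiv.surjective _).comp (Submodule.mkQ_surjective _)).comp hQ
    · have h1 : T (Q (F x)) = 0 := hx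
      have h2 : Q (F x) ∈ Submodule.span ℝ {e} := by
        rw [← Submodule.Quotient.mk_eq_zero]
        simpa [T] using h1
      obtain ⟨a, ha⟩ := Submodule.mem_span_singleton.1 h2
      by_contra hne
      have ha0 : a ≠ 0 := by
        rintro rfl
        exact hne (by rw [← ha, zero_smul])
      exact he' a⁻¹ x (by rw [← ha, smul_smul, inv_mul_cancel₀ ha0, one_smul])

/-- The kernel of the generic surjection has dimension `c`; `L` parametrizes it. -/
theorem exists_injective_forall_eq_zero [FiniteDimensional ℝ EM] [IsManifold 𝓘(ℝ, EM) ∞ M]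
    [SecondCountableTopology M] [Nonempty M] {n : ℕ} {F : M → (Fin n → ℝ)}
    (hF : ContMDiff 𝓘(ℝ, EM) 𝓘(ℝ, Fin n → ℝ) ∞ F) (c : ℕ)
    (hrank : ∀ x, ∃ W : Submodule ℝ (Fin n → ℝ), Module.finrank ℝ W + c < n ∧
      ∀ v, mfderiv 𝓘(ℝ, EM) 𝓘(ℝ, Fin n → ℝ) F x v ∈ W) :
    ∃ L : (Fin c → ℝ) →L[ℝ] (Fin n → ℝ), Function.Injective L ∧
      ∀ x t, F x = L t → F x = 0 := by
  obtain ⟨Q, hQ, hQF⟩ := exists_surjective_forall_eq_zero hF c hrank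
  have hcn : c < n := by
    obtain ⟨x₀⟩ := ‹Nonempty M›
    obtain ⟨W, h1, -⟩ := hrank x₀
    omega
  have hfin : Module.finrank ℝ (Fin c → ℝ) = Module.finrank ℝ (LinearMap.ker Q.toLinearMap) := by
    have := Q.toLinearMap.finrank_range_add_finrank_ker
    rw [LinearMap.range_eq_top.2 hQ, finrank_top, Module.finrank_fin_fun,
      Module.finrank_fin_fun] at this
    rw [Module.finrank_fin_fun]
    omega
  let e := LinearEquiv.ofFinrankEq _ _ hfin
  refine ⟨LinearMap.toContinuousLinearMap
    ((LinearMap.ker Q.toLinearMap).subtype ∘ₗ e.toLinearMap), ?_, fun x t h => hQF x ?_⟩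
  · exact Subtype.val_injective.comp e.injective
  · rw [h]
    exact (e t).2

end Presymplectic

/-! ### A retraction onto a closed embedded submanifold, smooth near it -/

namespace Presymplectic

open Set Filter

variable {EM : Type*} [NormedAddCommGroup EM] [NormedSpace ℝ EM]
  {M : Type*} [TopologicalSpace M] [ChartedSpace EM M]
  {EP : Type*} [NormedAddCommGroup EP] [NormedSpace ℝ EP]
  {P : Type*} [TopologicalSpace P] [ChartedSpace EP P]

/-- The map `r` is smooth on a neighbourhood of `p`. -/
def SmoothNear (EP EM : Type*) [NormedAddCommGroup EP] [NormedSpace ℝ EP] [NormedAddCommGroup EM]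
    [NormedSpace ℝ EM] {P M : Type*} [TopologicalSpace P] [ChartedSpace EP P]
    [TopologicalSpace M] [ChartedSpace EM M] (r : P → M) (p : P) : Prop :=
  ∀ᶠ q in 𝓝 p, ContMDiffAt 𝓘(ℝ, EP) 𝓘(ℝ, EM) ∞ r q

theorem SmoothNear.congr {r r' : P → M} {p : P} (h : SmoothNear EP EM r p) (hr : r' =ᶠ[𝓝 p] r) :
    SmoothNear EP EM r' p := by
  filter_upwards [h, eventually_eventually_nhds.2 hr] with q hq hq'
  exact hq.congr_of_eventuallyEq hq'

theorem isOpen_smoothNear (r : P → M) : IsOpen {p | SmoothNear EP EM r p} :=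
  isOpen_setOfPred_eventually_nhds

/-- A chart `φ` of `M` with convex target, with an extension `ρ` of it to an open set `V` of `P`
along `j : M → P`. -/
structure ChartExtension (EP EM : Type*) [NormedAddCommGroup EP] [NormedSpace ℝ EP]
    [NormedAddCommGroup EM] [NormedSpace ℝ EM] {P M : Type*} [TopologicalSpace P]
    [ChartedSpace EP P] [TopologicalSpace M] [ChartedSpace EM M] (j : M → P) where
  dom : Set P
  isOpen_dom : IsOpen dom
  chart : OpenPartialHomeomorph M EM
  smooth_chart : ContMDiffOn 𝓘(ℝ, EM) 𝓘(ℝ, EM) ∞ chart chart.source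
  smooth_symm : ContMDiffOn 𝓘(ℝ, EM) 𝓘(ℝ, EM) ∞ chart.symm chart.target
  convex_target : Convex ℝ chart.target
  ext : P → EM
  smooth_ext : ContMDiffOn 𝓘(ℝ, EP) 𝓘(ℝ, EM) ∞ ext dom
  mem_source : ∀ y, j y ∈ dom → y ∈ chart.source
  ext_apply : ∀ y, j y ∈ dom → ext (j y) = chart y

/-- In immersion charts `j` reads `u ↦ (u, 0)`, so the first component of the chart of `P` extends
the chart of `M`. Since `M` carries the induced topology, the open set of `P` can be shrunk until it
contains no point of `M` from outside the chart. -/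
theorem exists_chartExtension {j : M → P} [IsManifold 𝓘(ℝ, EM) ∞ M] [IsManifold 𝓘(ℝ, EP) ∞ P]
    (hj : Manifold.IsSmoothEmbedding 𝓘(ℝ, EM) 𝓘(ℝ, EP) ∞ j) (x : M) :
    ∃ C : ChartExtension EP EM j, j x ∈ C.dom := by
  have h := hj.isImmersion.isImmersionAt x
  set φ₀ := h.domChart
  set ψ := h.codChart
  have hx : x ∈ φ₀.source := h.mem_domChart_source
  obtain ⟨ε, hε, hball⟩ := Metric.isOpen_iff.1 φ₀.open_target (φ₀ x) (φ₀.map_source hx)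
  let φ := (φ₀.symm.restrOpen (Metric.ball (φ₀ x) ε) Metric.isOpen_ball).symm
  have hφt : φ.target = Metric.ball (φ₀ x) ε := by
    simp only [φ, OpenPartialHomeomorph.symm_target, OpenPartialHomeomorph.restrOpen_source,
      OpenPartialHomeomorph.symm_source]
    exact inter_eq_right.2 hball
  have hφs : φ.source ⊆ φ₀.source := by
    intro y hy
    have : φ y ∈ φ.target := φ.map_source hy
    rw [← φ.left_inv hy]
    exact φ₀.map_target (hball (hφt ▸ this))
  have hxφ : x ∈ φ.source := by
    have h1 : φ₀ x ∈ φ.target := by rw [hφt]; exact Metric.mem_ball_self hε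
    have h2 := φ.map_target h1
    have h3 : φ.symm (φ₀ x) = x := φ₀.left_inv hx
    rwa [h3] at h2
  obtain ⟨O, hO, hOφ⟩ := hj.isEmbedding.isInducing.isOpen_iff.1 φ.open_source
  have hmem : ∀ y, j y ∈ O → y ∈ φ.source := fun y hy => by rw [← hOφ]; exact hy
  refine ⟨⟨O ∩ ψ.source, hO.inter ψ.open_source, φ, ?_, ?_, ?_,
    fun p => (h.equiv.symm (ψ p)).1, ?_, fun y hy => hmem y hy.1, fun y hy => ?_⟩, ?_,
    h.mem_codChart_source⟩
  · exact (contMDiffOn_of_mem_maximalAtlas h.domChart_mem_maximalAtlas).mono hφs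
  · exact (contMDiffOn_symm_of_mem_maximalAtlas h.domChart_mem_maximalAtlas).mono
      (by rw [hφt]; exact hball)
  · rw [hφt]; exact convex_ball _ _
  · have h1 := (contMDiffOn_of_mem_maximalAtlas h.codChart_mem_maximalAtlas).mono
      (inter_subset_right (s := O))
    have h2 : ContDiff ℝ ∞ (fun z => (h.equiv.symm z).1) := contDiff_fst.comp h.equiv.symm.contDiff
    exact h2.contMDiff.comp_contMDiffOn h1
  · have hy₀ := hφs (hmem y hy.1)
    have h1 : φ₀ y ∈ (φ₀.extend 𝓘(ℝ, EM)).target := by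
      simpa using φ₀.map_source hy₀
    have h2 := h.writtenInCharts h1
    simp only [Function.comp_apply, OpenPartialHomeomorph.extend_coe,
      OpenPartialHomeomorph.extend_coe_symm, modelWithCornersSelf_coe,
      modelWithCornersSelf_coe_symm, id_eq] at h2
    change ψ (j (φ₀.symm (φ₀ y))) = _ at h2
    rw [φ₀.left_inv hy₀] at h2
    change (h.equiv.symm (ψ (j y))).1 = φ₀ y
    rw [h2]
    simp
  · change x ∈ j ⁻¹' O
    rw [hOφ]; exact hxφ

/-- A left inverse of `j`, smooth near a part of the image of `j`, can be modified inside the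
domain of a chart extension so as to become smooth near a further part of the image. -/
theorem ChartExtension.exists_smoothNear [FiniteDimensional ℝ EP] [IsManifold 𝓘(ℝ, EP) ∞ P]
    [T2Space P] [NormalSpace P] [SigmaCompactSpace P] {j : M → P} (hjc : IsClosed (range j))
    (C : ChartExtension EP EM j) {A v : Set P} (hA : IsClosed A) (hv : IsClosed v)
    (hvC : v ⊆ C.dom) {r : P → M} (hrj : ∀ x, r (j x) = x)
    (hr : ∀ x, j x ∈ A → SmoothNear EP EM r (j x)) :
    ∃ r' : P → M, (∀ x, r' (j x) = x) ∧ (∀ q, r' q ≠ r q → q ∈ C.dom) ∧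
      ∀ x, j x ∈ A ∪ v → SmoothNear EP EM r' (j x) := by
  classical
  set O := {p | SmoothNear EP EM r p}
  have hO : IsOpen O := isOpen_smoothNear r
  -- The cutoff is `0` near `A ∩ M`, which keeps `r` there, and off the domain; it is `1` near the
  -- points of `v ∩ M` where `r` is not yet smooth.
  have hd : Disjoint ((range j ∩ A) ∪ C.domᶜ) ((range j ∩ v) \ O) := by
    rw [Set.disjoint_left]
    rintro p (⟨⟨x, rfl⟩, hpA⟩ | hp) ⟨⟨_, hpv⟩, hpO⟩
    · exact hpO (hr x hpA)
    · exact hp (hvC hpv)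
  obtain ⟨χ, h0, h1, -⟩ := exists_contMDiffMap_zero_one_nhds_of_isClosed 𝓘(ℝ, EP) (n := ⊤)
    ((hjc.inter hA).union C.isOpen_dom.isClosed_compl)
    ((hjc.inter hv).sdiff hO) hd
  rw [eventually_nhdsSet_iff_forall] at h0 h1
  have hdom : ∀ q, χ q ≠ 0 → q ∈ C.dom := fun q hq => by
    by_contra hqd
    exact hq (h0 q (Or.inr hqd)).self_of_nhds
  -- Interpolation in the chart. Both terms agree on `M`, so the result is still a left inverse of
  -- `j`. Values where `comb` leaves the chart target are harmless, since this does not happen near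
  -- the points of `M` under consideration.
  let comb : P → EM := fun q => (1 - χ q) • C.chart (r q) + χ q • C.ext q
  have hcombj : ∀ x, j x ∈ C.dom → comb (j x) = C.chart x := fun x hx => by
    simp only [comb, hrj, C.ext_apply x hx, ← add_smul, sub_add_cancel, one_smul]
  let r' : P → M := fun q => if χ q = 0 then r q else C.chart.symm (comb q)
  refine ⟨r', fun x => ?_, fun q hq => ?_, fun x hx => ?_⟩
  · by_cases hx : χ (j x) = 0
    · simp only [r', hx, if_true, hrj]
    · simp only [r', hx, if_false]
      rw [hcombj x (hdom _ hx), C.chart.left_inv (C.mem_source x (hdom _ hx))]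
  · refine hdom q fun h => hq ?_
    simp only [r', h, if_true]
  · by_cases hxA : j x ∈ A
    · refine (hr x hxA).congr ?_
      filter_upwards [h0 (j x) (Or.inl ⟨mem_range_self x, hxA⟩)] with q hq
      simp only [r', hq, if_true]
    · have hxv : j x ∈ v := hx.resolve_left hxA
      have hxd : j x ∈ C.dom := hvC hxv
      have hxs := C.mem_source x hxd
      have hdomx : ∀ᶠ q in 𝓝 (j x), q ∈ C.dom := C.isOpen_dom.mem_nhds hxd
      have hext : ∀ q ∈ C.dom, ContMDiffAt 𝓘(ℝ, EP) 𝓘(ℝ, EM) ∞ C.ext q := fun q hq =>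
        C.smooth_ext.contMDiffAt (C.isOpen_dom.mem_nhds hq)
      have hsymm : ∀ z ∈ C.chart.target, ContMDiffAt 𝓘(ℝ, EM) 𝓘(ℝ, EM) ∞ C.chart.symm z :=
        fun z hz => C.smooth_symm.contMDiffAt (C.chart.open_target.mem_nhds hz)
      have hchart : ∀ z ∈ C.chart.source, ContMDiffAt 𝓘(ℝ, EM) 𝓘(ℝ, EM) ∞ C.chart z :=
        fun z hz => C.smooth_chart.contMDiffAt (C.chart.open_source.mem_nhds hz)
      have hexttar : ∀ᶠ q in 𝓝 (j x), C.ext q ∈ C.chart.target :=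
        (hext _ hxd).continuousAt.eventually_mem (C.chart.open_target.mem_nhds (by
          rw [C.ext_apply x hxd]; exact C.chart.map_source hxs))
      -- If `r` is smooth near `j x`, the interpolation formula also holds where `χ = 0`; otherwise
      -- `χ = 1` nearby and `r` drops out.
      by_cases hxO : j x ∈ O
      · have hrsrc : ∀ᶠ q in 𝓝 (j x), r q ∈ C.chart.source :=
          (hxO.self_of_nhds).continuousAt.eventually_mem (C.chart.open_source.mem_nhds (by
            rw [hrj]; exact hxs))
        have hr' : r' =ᶠ[𝓝 (j x)] fun q => C.chart.symm (comb q) := by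
          filter_upwards [hrsrc] with q hq
          by_cases h : χ q = 0
          · simp only [r', comb, h, if_true, sub_zero, one_smul, zero_smul, add_zero]
            rw [C.chart.left_inv hq]
          · simp only [r', h, if_false]
        have hcomb : ∀ q, q ∈ C.dom → r q ∈ C.chart.source →
            ContMDiffAt 𝓘(ℝ, EP) 𝓘(ℝ, EM) ∞ r q →
            ContMDiffAt 𝓘(ℝ, EP) 𝓘(ℝ, EM) ∞ comb q := fun q hq1 hq2 hq3 =>
          ((contMDiffAt_const.sub χ.contMDiff.contMDiffAt).smul ((hchart _ hq2).comp q hq3)).add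
            (χ.contMDiff.contMDiffAt.smul (hext q hq1))
        have htar : ∀ᶠ q in 𝓝 (j x), comb q ∈ C.chart.target :=
          (hcomb _ hxd (by rw [hrj]; exact hxs)
            hxO.self_of_nhds).continuousAt.eventually_mem (C.chart.open_target.mem_nhds (by
              rw [hcombj x hxd]; exact C.chart.map_source hxs))
        refine SmoothNear.congr ?_ hr'
        filter_upwards [hdomx, hrsrc, htar, hxO] with q h1 h2 h3 h4
        exact (hsymm _ h3).comp q (hcomb q h1 h2 h4)
      · have hr' : r' =ᶠ[𝓝 (j x)] fun q => C.chart.symm (C.ext q) := by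
          filter_upwards [h1 (j x) ⟨⟨mem_range_self x, hxv⟩, hxO⟩] with q hq
          simp only [r', comb, hq, one_ne_zero, if_false, sub_self, zero_smul, one_smul, zero_add]
        refine SmoothNear.congr ?_ hr'
        filter_upwards [hdomx, hexttar] with q h1 h2
        exact (hsymm _ h2).comp q (hext q h1)

/-- A closed embedded submanifold has a retraction which is smooth near it. -/
theorem exists_smooth_retraction [FiniteDimensional ℝ EP] [IsManifold 𝓘(ℝ, EP) ∞ P]
    [T2Space P] [SecondCountableTopology P] [IsManifold 𝓘(ℝ, EM) ∞ M] [SecondCountableTopology M]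
    [Nonempty M] {j : M → P} (hj : Manifold.IsSmoothEmbedding 𝓘(ℝ, EM) 𝓘(ℝ, EP) ∞ j)
    (hjc : IsClosed (range j)) :
    ∃ r : P → M, (∀ x, r (j x) = x) ∧ ∀ x, SmoothNear EP EM r (j x) := by
  have : LocallyCompactSpace P := Manifold.locallyCompact_of_finiteDimensional 𝓘(ℝ, EP)
  choose C hC using fun x => exists_chartExtension (EP := EP) hj x
  obtain ⟨t, htc, ht⟩ := TopologicalSpace.countable_cover_nhds (f := fun x => j ⁻¹' (C x).dom)
    fun x => ((C x).isOpen_dom.preimage hj.isEmbedding.continuous).mem_nhds (hC x)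
  have htne : t.Nonempty := by
    rw [nonempty_iff_ne_empty]
    rintro rfl
    simp only [mem_empty_iff_false, iUnion_of_empty, iUnion_empty] at ht
    exact empty_ne_univ ht
  obtain ⟨a, rfl⟩ := htc.exists_eq_range htne
  obtain ⟨w, hwo, hwcov, hwfin, hw⟩ := precise_refinement_set hjc (fun n => (C (a n)).dom)
    (fun n => (C (a n)).isOpen_dom) (by
      rintro _ ⟨x, rfl⟩
      have := ht.symm ▸ mem_univ x
      simpa using this)
  obtain ⟨v, hvcov, hvc, hvw⟩ := exists_subset_iUnion_closed_subset hjc hwo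
    (fun x _ => hwfin.point_finite x) hwcov
  let D : ℕ → ChartExtension EP EM j := fun n =>
    { C (a n) with
      dom := w n
      isOpen_dom := hwo n
      smooth_ext := (C (a n)).smooth_ext.mono (hw n)
      mem_source := fun y hy => (C (a n)).mem_source y (hw n hy)
      ext_apply := fun y hy => (C (a n)).ext_apply y (hw n hy) }
  -- Smoothness is gained one closed set `v n` at a time, starting from an arbitrary left inverse;
  -- stage `n` changes the map only inside `w n`.
  let Good : ℕ → (P → M) → Prop := fun n r => (∀ x, r (j x) = x) ∧
    ∀ x, j x ∈ (⋃ i ∈ Finset.range n, v i) → SmoothNear EP EM r (j x)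
  have hstep : ∀ n (r : {r // Good n r}), ∃ r' : {r // Good (n + 1) r},
      ∀ q, r'.1 q ≠ r.1 q → q ∈ w n := by
    rintro n ⟨r, hr1, hr2⟩
    obtain ⟨r', h1, h2, h3⟩ := (D n).exists_smoothNear hjc
      ((Finset.range n).finite_toSet.isClosed_biUnion fun i _ => hvc i) (hvc n) (hvw n) hr1
      (fun x hx => hr2 x (by simpa using hx))
    refine ⟨⟨r', h1, fun x hx => h3 x ?_⟩, h2⟩
    simp only [mem_iUnion, Finset.mem_range, exists_prop] at hx
    obtain ⟨i, hi, hxi⟩ := hx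
    rcases Nat.lt_succ_iff_lt_or_eq.1 hi with hi | rfl
    · exact Or.inl (mem_biUnion (by simpa using hi) hxi)
    · exact Or.inr hxi
  choose next hnext using hstep
  have hbase : Good 0 (Function.invFun j) :=
    ⟨Function.leftInverse_invFun hj.isEmbedding.injective, fun x hx => by simp at hx⟩
  let seq : ∀ n, {r // Good n r} := fun n => Nat.rec ⟨_, hbase⟩ next n
  -- Local finiteness of `w` makes the sequence stationary near every point, so its limit is smooth
  -- wherever a late stage is.
  obtain ⟨F, hF⟩ := (hwfin.subset (g := fun n => {q | (seq (n + 1)).1 q ≠ (seq n).1 q})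
    fun n q hq => hnext n (seq n) q hq).exists_forall_eventually_atTop_eventuallyEq
      (f := fun n => (seq n).1)
  refine ⟨F, fun x => ?_, fun x => ?_⟩
  · obtain ⟨n, hn⟩ := (hF (j x)).exists
    rw [← hn.self_of_nhds]
    exact (seq n).2.1 x
  · obtain ⟨i, hi⟩ := mem_iUnion.1 (hvcov (mem_range_self x))
    obtain ⟨n, hn, hni⟩ := ((hF (j x)).and (eventually_gt_atTop i)).exists
    refine ((seq n).2.2 x ?_).congr hn.symm
    exact mem_biUnion (by simpa using hni) hi

end Presymplectic

/-! ### Extension from the zero set without new zeros -/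

namespace Presymplectic

open Set Filter

/-- Let `M` be the regular zero set of `c` functions on `P`. A smooth map `M → ℝⁿ` of rank less than
`n - c` extends smoothly to `P` without acquiring new zeros. -/
theorem exists_extension_without_new_zeros
    {EM : Type*} [NormedAddCommGroup EM] [NormedSpace ℝ EM] [FiniteDimensional ℝ EM]
    {M : Type*} [TopologicalSpace M] [ChartedSpace EM M] [IsManifold 𝓘(ℝ, EM) ∞ M]
    [SecondCountableTopology M] [Nonempty M]
    {EP : Type*} [NormedAddCommGroup EP] [NormedSpace ℝ EP] [FiniteDimensional ℝ EP]
    {P : Type*} [TopologicalSpace P] [ChartedSpace EP P] [IsManifold 𝓘(ℝ, EP) ∞ P]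
    [T2Space P] [SecondCountableTopology P] {j : M → P} (hjc : IsClosed (range j))
    {r : P → M} (hrj : ∀ x, r (j x) = x) (hr : ∀ x, SmoothNear EP EM r (j x))
    {c n : ℕ} {η : Fin c → P → ℝ} (hη : ∀ i, ContMDiff 𝓘(ℝ, EP) 𝓘(ℝ, ℝ) ∞ (η i))
    (hzero : range j = {p | ∀ i, η i p = 0}) {F : M → (Fin n → ℝ)}
    (hF : ContMDiff 𝓘(ℝ, EM) 𝓘(ℝ, Fin n → ℝ) ∞ F)
    (hrank : ∀ x, ∃ W : Submodule ℝ (Fin n → ℝ), Module.finrank ℝ W + c < n ∧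
      ∀ v, mfderiv 𝓘(ℝ, EM) 𝓘(ℝ, Fin n → ℝ) F x v ∈ W) :
    ∃ K : P → (Fin n → ℝ), ContMDiff 𝓘(ℝ, EP) 𝓘(ℝ, Fin n → ℝ) ∞ K ∧ (∀ x, K (j x) = F x) ∧
      ∀ p, K p = 0 → p ∈ range j := by
  have : LocallyCompactSpace P := Manifold.locallyCompact_of_finiteDimensional 𝓘(ℝ, EP)
  obtain ⟨L, hL, hLF⟩ := exists_injective_forall_eq_zero hF c hrank
  set O := {p | SmoothNear EP EM r p}
  have hO : IsOpen O := isOpen_smoothNear r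
  obtain ⟨χ, h0, h1, -⟩ := exists_contMDiffMap_zero_one_nhds_of_isClosed 𝓘(ℝ, EP) (n := ⊤)
    hO.isClosed_compl hjc (by
      rw [Set.disjoint_left]
      rintro p hp ⟨x, rfl⟩
      exact hp (hr x))
  rw [eventually_nhdsSet_iff_forall] at h0 h1
  have hχj : ∀ x, χ (j x) = 1 := fun x => (h1 _ (mem_range_self x)).self_of_nhds
  have hηj : ∀ x, (fun i => η i (j x)) = 0 := fun x => by
    have : j x ∈ {p | ∀ i, η i p = 0} := hzero ▸ mem_range_self x
    exact funext this
  have hmem : ∀ p, (fun i => η i p) = 0 → p ∈ range j := fun p hp => by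
    rw [hzero]; exact fun i => congrFun hp i
  have hηs : ContMDiff 𝓘(ℝ, EP) 𝓘(ℝ, Fin n → ℝ) ∞ (fun p => L fun i => η i p) :=
    L.contDiff.contMDiff.comp (contMDiff_pi_space.2 hη)
  refine ⟨fun p => χ p • F (r p) + L fun i => η i p, ?_, fun x => ?_, fun p hp => ?_⟩
  · refine ContMDiff.add (fun p => ?_) hηs
    by_cases hp : p ∈ O
    · exact χ.contMDiff.contMDiffAt.smul ((hF _).comp p hp.self_of_nhds)
    · refine (contMDiffAt_const (c := (0 : Fin n → ℝ))).congr_of_eventuallyEq ?_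
      filter_upwards [h0 p hp] with q hq
      rw [hq, zero_smul]
  · simp only [hχj, hrj, hηj, one_smul, map_zero, add_zero]
  · simp only at hp
    by_cases hχ : χ p = 0
    · rw [hχ, zero_smul, zero_add] at hp
      exact hmem p (hL (by rw [hp, map_zero]))
    -- `K p = 0` puts `F (r p)` in the range of `L`, which by the choice of `L` makes it vanish.
    · have h2 : F (r p) = L (-(χ p)⁻¹ • fun i => η i p) := by
        rw [map_smul, neg_smul, ← smul_neg, ← eq_neg_of_add_eq_zero_left hp, smul_smul,
          inv_mul_cancel₀ hχ, one_smul]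
      rw [hLF _ _ h2, smul_zero, zero_add] at hp
      exact hmem p (hL (by rw [hp, map_zero]))

end Presymplectic

/-! ### Smooth sections of kernels of constant dimension -/

namespace Presymplectic

open Set Filter

variable {EP : Type*} [NormedAddCommGroup EP] [NormedSpace ℝ EP]
  {P : Type*} [TopologicalSpace P] [ChartedSpace EP P]

/-- A vector in the kernel of a member of a smooth family of linear maps of constant rank extends to
a smooth family of vectors in the kernels. -/
theorem exists_smooth_kernel_family {E F : Type*} [NormedAddCommGroup E] [NormedSpace ℝ E]
    [FiniteDimensional ℝ E] [NormedAddCommGroup F] [NormedSpace ℝ F] [FiniteDimensional ℝ F]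
    {A : P → (E →L[ℝ] F)} {p₀ : P}
    (hA : ∀ᶠ p in 𝓝 p₀, ContMDiffAt 𝓘(ℝ, EP) 𝓘(ℝ, E →L[ℝ] F) ∞ A p)
    (hk : ∀ᶠ p in 𝓝 p₀, Module.finrank ℝ (LinearMap.ker (A p).toLinearMap) =
      Module.finrank ℝ (LinearMap.ker (A p₀).toLinearMap))
    {u₀ : E} (hu₀ : A p₀ u₀ = 0) :
    ∃ u : P → E, u p₀ = u₀ ∧
      ∀ᶠ p in 𝓝 p₀, ContMDiffAt 𝓘(ℝ, EP) 𝓘(ℝ, E) ∞ u p ∧ A p (u p) = 0 := by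
  obtain ⟨W, hW⟩ := Submodule.exists_isCompl (LinearMap.ker (A p₀).toLinearMap)
  let ι : W →L[ℝ] E := W.subtypeL
  have hinj : LinearMap.ker ((A p₀).comp ι).toLinearMap = ⊥ := by
    rw [LinearMap.ker_eq_bot']
    intro w hw
    have h1 : (w : E) ∈ LinearMap.ker (A p₀).toLinearMap := hw
    have h2 := hW.disjoint.le_bot ⟨h1, w.2⟩
    exact Subtype.ext h2
  obtain ⟨ρ₀, hρ₀⟩ := LinearMap.exists_leftInverse_of_injective _ hinj
  let ρ : F →L[ℝ] W := LinearMap.toContinuousLinearMap ρ₀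
  -- `B` is the identity at `p₀`, hence invertible nearby. Subtracting `B⁻¹ ρ A u₀` projects `u₀`
  -- along `W` onto the kernel of `ρ A`.
  let B : P → (W →L[ℝ] W) := fun p => ρ.comp ((A p).comp ι)
  have hB₀ : B p₀ = (ContinuousLinearEquiv.refl ℝ W : W →L[ℝ] W) := by
    ext1 w
    exact congrArg (fun L => L w) hρ₀
  have hBs : ∀ p, ContMDiffAt 𝓘(ℝ, EP) 𝓘(ℝ, E →L[ℝ] F) ∞ A p →
      ContMDiffAt 𝓘(ℝ, EP) 𝓘(ℝ, W →L[ℝ] W) ∞ B p := fun p hp =>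
    contMDiffAt_const.clm_comp (hp.clm_comp contMDiffAt_const)
  have hBinv : ∀ᶠ p in 𝓝 p₀, ∃ e : W ≃L[ℝ] W, (e : W →L[ℝ] W) = B p := by
    have h1 := (ContinuousLinearEquiv.nhds (ContinuousLinearEquiv.refl ℝ W))
    rw [← hB₀] at h1
    exact (hBs p₀ hA.self_of_nhds).continuousAt.eventually_mem h1
  refine ⟨fun p => u₀ - ι ((B p).inverse (ρ (A p u₀))), ?_, ?_⟩
  · simp only [hu₀, map_zero, sub_zero]
  · filter_upwards [hA, hk, hBinv] with p hp hkp ⟨e, he⟩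
    refine ⟨?_, ?_⟩
    · have h1 : ContMDiffAt 𝓘(ℝ, EP) 𝓘(ℝ, W →L[ℝ] W) ∞ (fun p => (B p).inverse) p := by
        have h2 : ContDiffAt ℝ ∞ (ContinuousLinearMap.inverse (R := ℝ) (M := W) (M₂ := W)) (B p) := by
          rw [← he]; exact contDiffAt_map_inverse e
        exact h2.contMDiffAt.comp p (hBs p hp)
      have h3 : ContMDiffAt 𝓘(ℝ, EP) 𝓘(ℝ, W) ∞ (fun p => ρ (A p u₀)) p :=
        contMDiffAt_const.clm_apply (hp.clm_apply contMDiffAt_const)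
      exact contMDiffAt_const.sub (contMDiffAt_const.clm_apply (h1.clm_apply h3))
    -- Constancy of the rank enters here: `ker A ⊆ ker (ρ A)` always holds, and the dimensions
    -- agree.
    · have hker : LinearMap.ker (A p).toLinearMap =
          LinearMap.ker (ρ.comp (A p)).toLinearMap := by
        refine Submodule.eq_of_le_of_finrank_le (fun v hv => ?_) ?_
        · have hv' : A p v = 0 := hv
          change ρ (A p v) = 0
          rw [hv', map_zero]
        · have h1 := (ρ.comp (A p)).toLinearMap.finrank_range_add_finrank_ker
          have h2 := (A p₀).toLinearMap.finrank_range_add_finrank_ker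
          have h3 := Submodule.finrank_add_eq_of_isCompl hW
          have h4 : LinearMap.range (ρ.comp (A p)).toLinearMap = ⊤ := by
            rw [LinearMap.range_eq_top]
            intro w
            refine ⟨ι (e.symm w), ?_⟩
            change B p (e.symm w) = w
            rw [← he]
            exact e.apply_symm_apply w
          rw [h4, finrank_top] at h1
          omega
      change _ ∈ LinearMap.ker (A p).toLinearMap
      rw [hker]
      change ρ (A p (u₀ - ι ((B p).inverse (ρ (A p u₀))))) = 0
      rw [map_sub, map_sub, sub_eq_zero]
      change _ = B p ((B p).inverse (ρ (A p u₀)))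
      rw [← he, ContinuousLinearMap.inverse_equiv]
      exact (e.apply_symm_apply _).symm

set_option synthInstance.maxHeartbeats 400000 in
/-- A vector in the kernel of a smooth bilinear form of constant rank extends to a smooth vector
field in the kernel. -/
theorem exists_smoothField_mem_ker [FiniteDimensional ℝ EP] [IsManifold 𝓘(ℝ, EP) ∞ P] [T2Space P]
    [SecondCountableTopology P]
    {σ : ∀ p : P, TangentSpace 𝓘(ℝ, EP) p →L[ℝ] TangentSpace 𝓘(ℝ, EP) p →L[ℝ] ℝ}
    (hσ : IsSmoothBilin σ) {k : ℕ}
    (hk : ∀ p : P, Module.finrank ℝ (LinearMap.ker (σ p).toLinearMap) = k) {p₀ : P}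
    {v : TangentSpace 𝓘(ℝ, EP) p₀} (hv : σ p₀ v = 0) :
    ∃ Y : ∀ p : P, TangentSpace 𝓘(ℝ, EP) p, IsSmoothField Y ∧ (∀ p, σ p (Y p) = 0) ∧ Y p₀ = v := by
  have : LocallyCompactSpace P := Manifold.locallyCompact_of_finiteDimensional 𝓘(ℝ, EP)
  let e₁ := trivializationAt EP (TangentSpace 𝓘(ℝ, EP) : P → Type _) p₀
  let e₂ := trivializationAt (EP →L[ℝ] ℝ)
    (fun p : P => TangentSpace 𝓘(ℝ, EP) p →L[ℝ] ℝ) p₀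
  let e := trivializationAt (EP →L[ℝ] EP →L[ℝ] ℝ)
    (fun p : P => TangentSpace 𝓘(ℝ, EP) p →L[ℝ] TangentSpace 𝓘(ℝ, EP) p →L[ℝ] ℝ) p₀
  have hb₁ : p₀ ∈ e₁.baseSet := mem_baseSet_trivializationAt _ _ p₀
  have hb₂ : p₀ ∈ e₂.baseSet := mem_baseSet_trivializationAt _ _ p₀
  have hb : p₀ ∈ e.baseSet := mem_baseSet_trivializationAt _ _ p₀
  -- `σ` read in trivializations: its kernel corresponds to that of `σ p`, so the local result
  -- applies; a cutoff then makes the field global.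
  let A : P → (EP →L[ℝ] EP →L[ℝ] ℝ) := fun p => (e ⟨p, σ p⟩).2
  have hAs : ∀ p ∈ e.baseSet, ContMDiffAt 𝓘(ℝ, EP) 𝓘(ℝ, EP →L[ℝ] EP →L[ℝ] ℝ) ∞ A p := fun p hp =>
    (e.contMDiffAt_section_iff hp).1 (hσ p)
  have hAeq : ∀ p (u : EP),
      A p u = e₂.continuousLinearMapAt ℝ p (σ p (e₁.symmL ℝ p u)) := fun p u => rfl
  have hA0 : ∀ p, p ∈ e₂.baseSet → ∀ u, A p u = 0 ↔ σ p (e₁.symmL ℝ p u) = 0 := by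
    intro p hp u
    refine ⟨fun h => ?_, fun h => by rw [hAeq, h, map_zero]⟩
    rw [hAeq] at h
    rw [← e₂.symmL_continuousLinearMapAt (R := ℝ) hp (σ p (e₁.symmL ℝ p u)), h, map_zero]
  have hAk : ∀ p, p ∈ e₁.baseSet → p ∈ e₂.baseSet →
      Module.finrank ℝ (LinearMap.ker (A p).toLinearMap) = k := by
    intro p h₁ h₂
    rw [← hk p]
    let L := (e₁.continuousLinearEquivAt ℝ p h₁).symm.toLinearEquiv
    have hL : ∀ u, L u = e₁.symmL ℝ p u := fun u =>
      congrFun (e₁.symm_continuousLinearEquivAt_eq h₁) u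
    have h3 : LinearMap.ker (A p).toLinearMap =
        (LinearMap.ker (σ p).toLinearMap).comap L.toLinearMap := by
      ext u
      refine (hA0 p h₂ u).trans ?_
      rw [← hL]
      rfl
    rw [h3]
    exact (L.ofSubmodule' _).finrank_eq
  obtain ⟨u, hu0, hu⟩ := exists_smooth_kernel_family (A := A) (p₀ := p₀)
    (u₀ := e₁.continuousLinearMapAt ℝ p₀ v)
    (Filter.eventually_of_mem (e.open_baseSet.mem_nhds hb) hAs) (by
      filter_upwards [e₁.open_baseSet.mem_nhds hb₁, e₂.open_baseSet.mem_nhds hb₂] with p h₁ h₂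
      rw [hAk p h₁ h₂, hAk p₀ hb₁ hb₂]) (by
      rw [hA0 p₀ hb₂, e₁.symmL_continuousLinearMapAt hb₁]
      exact hv)
  have hgood : ∀ᶠ p in 𝓝 p₀, p ∈ e₁.baseSet ∧ p ∈ e₂.baseSet ∧
      ContMDiffAt 𝓘(ℝ, EP) 𝓘(ℝ, EP) ∞ u p ∧ A p (u p) = 0 := by
    filter_upwards [e₁.open_baseSet.mem_nhds hb₁, e₂.open_baseSet.mem_nhds hb₂, hu] with p h₁ h₂ h₃
    exact ⟨h₁, h₂, h₃⟩
  obtain ⟨O, hOsub, hO, hpO⟩ := eventually_nhds_iff.1 hgood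
  obtain ⟨χ, h0, h1, -⟩ := exists_contMDiffMap_zero_one_nhds_of_isClosed 𝓘(ℝ, EP) (n := ⊤)
    (s := Oᶜ) (t := {p₀}) hO.isClosed_compl isClosed_singleton
    (Set.disjoint_singleton_right.2 fun h => h hpO)
  rw [eventually_nhdsSet_iff_forall] at h0 h1
  refine ⟨fun p => e₁.symmL ℝ p (χ p • u p), fun p => ?_, fun p => ?_, ?_⟩
  · by_cases hp : p ∈ O
    · obtain ⟨hp₁, -, hp₃, -⟩ := hOsub p hp
      refine (e₁.contMDiffAt_section_iff hp₁).2 ?_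
      refine (χ.contMDiff.contMDiffAt.smul hp₃).congr_of_eventuallyEq ?_
      filter_upwards [e₁.open_baseSet.mem_nhds hp₁] with q hq
      rw [e₁.symmL_apply hq, e₁.apply_mk_symm hq]
      rfl
    · refine (contMDiff_zeroSection ℝ (TangentSpace 𝓘(ℝ, EP) : P → Type _)
        p).congr_of_eventuallyEq ?_
      filter_upwards [h0 p hp] with q hq
      rw [hq, zero_smul, map_zero]
      rfl
  · change σ p (e₁.symmL ℝ p (χ p • u p)) = 0
    by_cases hp : p ∈ O
    · obtain ⟨-, hp₂, -, hp₃⟩ := hOsub p hp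
      rw [← hA0 p hp₂, map_smul, hp₃, smul_zero]
    · rw [(h0 p hp).self_of_nhds, zero_smul, map_zero, map_zero]
  · have hχ : χ p₀ = 1 := (h1 p₀ rfl).self_of_nhds
    simp only [hχ, one_smul, hu0]
    exact e₁.symmL_continuousLinearMapAt hb₁ v

end Presymplectic

/-! ### Vectors and vector fields tangent to a level set -/

namespace Presymplectic

open Set Filter

/-- If `a ∘ b` is the identity on a regular level set of `g`, then the composition of the
differentials is the identity on the kernel of the differential of `g`. -/
theorem eq_fderiv_fderiv_of_level_set {E E' G : Type*} [NormedAddCommGroup E] [NormedSpace ℝ E]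
    [CompleteSpace E] [NormedAddCommGroup E'] [NormedSpace ℝ E'] [NormedAddCommGroup G]
    [NormedSpace ℝ G] [FiniteDimensional ℝ G] {g : E → G} {g' : E →L[ℝ] G} {a : E' → E} {b : E → E'}
    {z₀ : E} (hg : HasStrictFDerivAt g g' z₀) (hsurj : Function.Surjective g')
    (ha : DifferentiableAt ℝ a (b z₀)) (hb : DifferentiableAt ℝ b z₀)
    (hab : ∀ᶠ z in 𝓝 z₀, g z = g z₀ → a (b z) = z) {w : E} (hw : g' w = 0) :
    fderiv ℝ a (b z₀) (fderiv ℝ b z₀ w) = w := by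
  have hr : LinearMap.range g'.toLinearMap = ⊤ := LinearMap.range_eq_top.2 hsurj
  -- `γ` parametrizes the level set by `ker g'` and has the inclusion as derivative at `0`;
  -- differentiating `a ∘ b ∘ γ = γ` gives the claim.
  let γ := hg.implicitFunction g g' hr (g z₀)
  have hγ : HasStrictFDerivAt γ (LinearMap.ker g'.toLinearMap).subtypeL 0 :=
    hg.to_implicitFunction hr
  have hγ0 : γ 0 = z₀ := hg.implicitFunction_apply_image hr
  have hgγ : ∀ᶠ k in 𝓝 (0 : LinearMap.ker g'.toLinearMap), g (γ k) = g z₀ := by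
    have h1 := hg.map_implicitFunction_eq hr
    have h2 : Tendsto (fun k : LinearMap.ker g'.toLinearMap => (g z₀, k)) (𝓝 0) (𝓝 (g z₀, 0)) :=
      (Continuous.prodMk_right (g z₀)).tendsto 0
    exact h2.eventually h1
  have habγ : ∀ᶠ k in 𝓝 (0 : LinearMap.ker g'.toLinearMap), a (b (γ k)) = γ k := by
    have h1 : Tendsto γ (𝓝 0) (𝓝 z₀) := by
      have := hγ.hasFDerivAt.continuousAt.tendsto
      rwa [hγ0] at this
    filter_upwards [h1.eventually hab, hgγ] with k hk hk'
    exact hk hk'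
  have hd : HasFDerivAt (fun k => a (b (γ k)))
      ((fderiv ℝ a (b z₀)).comp ((fderiv ℝ b z₀).comp
        (LinearMap.ker g'.toLinearMap).subtypeL)) 0 := by
    rw [← hγ0] at ha hb ⊢
    exact ha.hasFDerivAt.comp 0 (hb.hasFDerivAt.comp 0 hγ.hasFDerivAt)
  have huniq := hd.unique (hγ.hasFDerivAt.congr_of_eventuallyEq habγ)
  exact congrArg (fun L => L ⟨w, hw⟩) huniq

variable {EM : Type*} [NormedAddCommGroup EM] [NormedSpace ℝ EM]
  {M : Type*} [TopologicalSpace M] [ChartedSpace EM M]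
  {EP : Type*} [NormedAddCommGroup EP] [NormedSpace ℝ EP]
  {P : Type*} [TopologicalSpace P] [ChartedSpace EP P]

theorem mfderiv_retraction_apply {j : M → P} {r : P → M} (hrj : ∀ x, r (j x) = x) {x : M}
    (hj : MDifferentiableAt 𝓘(ℝ, EM) 𝓘(ℝ, EP) j x)
    (hr : MDifferentiableAt 𝓘(ℝ, EP) 𝓘(ℝ, EM) r (j x)) (v : EM) :
    (mfderiv 𝓘(ℝ, EP) 𝓘(ℝ, EM) r (j x) (mfderiv 𝓘(ℝ, EM) 𝓘(ℝ, EP) j x v) : EM) = v := by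
  have h1 := (hr.hasMFDerivAt.comp x hj.hasMFDerivAt)
  have h2 : r ∘ j = id := funext hrj
  have h3 := (hasMFDerivAt_id (I := 𝓘(ℝ, EM)) x)
  rw [← h2] at h3
  have h4 := hasMFDerivAt_unique h1 h3
  exact congrArg (fun L : EM →L[ℝ] EM => L v) h4

/-- A smooth vector field tangent to an embedded submanifold restricts to a smooth vector field on
the submanifold. -/
theorem exists_smoothField_restriction [IsManifold 𝓘(ℝ, EM) ∞ M] [IsManifold 𝓘(ℝ, EP) ∞ P]
    {j : M → P} (hj : ContMDiff 𝓘(ℝ, EM) 𝓘(ℝ, EP) ∞ j) {r : P → M} (hrj : ∀ x, r (j x) = x)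
    (hr : ∀ x, SmoothNear EP EM r (j x)) {Y : ∀ p : P, TangentSpace 𝓘(ℝ, EP) p}
    (hY : IsSmoothField Y) (hYj : IsTangentTo (F := EM) j Y) :
    ∃ Z : ∀ x : M, TangentSpace 𝓘(ℝ, EM) x, IsSmoothField Z ∧
      ∀ x, mfderiv 𝓘(ℝ, EM) 𝓘(ℝ, EP) j x (Z x) = Y (j x) := by
  have : IsManifold 𝓘(ℝ, EM) 1 M := IsManifold.of_le (n := ∞) (by simp)
  have : IsManifold 𝓘(ℝ, EP) 1 P := IsManifold.of_le (n := ∞) (by simp)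
  choose Z hZ using hYj
  refine ⟨Z, ?_, hZ⟩
  set O := {p | SmoothNear EP EM r p}
  have hO : IsOpen O := isOpen_smoothNear r
  have hrO : ContMDiffOn 𝓘(ℝ, EP) 𝓘(ℝ, EM) ∞ r O := fun p hp =>
    hp.self_of_nhds.contMDiffWithinAt
  have hT := hrO.contMDiffOn_tangentMapWithin (m := ∞) (by simp) hO.uniqueMDiffOn
  have hYj' : ContMDiff 𝓘(ℝ, EM) 𝓘(ℝ, EP).tangent ∞
      (fun x => (TotalSpace.mk' EP (j x) (Y (j x)) : TangentBundle 𝓘(ℝ, EP) P)) := hY.comp hj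
  have hcomp := hT.comp_contMDiff hYj' (fun x => hr x)
  -- `Z` is `dr` applied to `Y` along `j`. Its base point is `r (j x)`, only propositionally equal
  -- to `x`, hence this transport.
  have hmk : ∀ (y x : M) (_ : y = x) (w : EM),
      (TotalSpace.mk' EM y w : TangentBundle 𝓘(ℝ, EM) M) = TotalSpace.mk' EM x w := by
    rintro y _ rfl w
    rfl
  refine hcomp.congr fun x => ?_
  have h1 : MDifferentiableAt 𝓘(ℝ, EP) 𝓘(ℝ, EM) r (j x) :=
    ((hr x).self_of_nhds).mdifferentiableAt (by simp)
  have h2 := mfderiv_retraction_apply hrj ((hj x).mdifferentiableAt (by simp)) h1 (Z x)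
  rw [hZ] at h2
  refine (hmk _ x (hrj x) (Z x)).symm.trans ?_
  simp only [Function.comp_apply, tangentMapWithin]
  rw [mfderivWithin_of_isOpen hO (hr x)]
  exact congrArg (fun w : EM => (TotalSpace.mk' EM (r (j x)) w : TangentBundle 𝓘(ℝ, EM) M)) h2.symm

/-- A tangent vector annihilated by the differentials of the functions of a constraint basis is
tangent to the submanifold. -/
theorem IsConstraintBasis.exists_mfderiv_eq [FiniteDimensional ℝ EP] [IsManifold 𝓘(ℝ, EM) ∞ M]
    [IsManifold 𝓘(ℝ, EP) ∞ P] {j : M → P} {c : ℕ} {η : Fin c → P → ℝ}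
    (hη : IsConstraintBasis (E := EP) j η) (hj : ContMDiff 𝓘(ℝ, EM) 𝓘(ℝ, EP) ∞ j) {r : P → M}
    (hrj : ∀ x, r (j x) = x) {x : M} (hr : SmoothNear EP EM r (j x))
    {v : TangentSpace 𝓘(ℝ, EP) (j x)} (hv : ∀ i, diff (η i) (j x) v = 0) :
    ∃ w : TangentSpace 𝓘(ℝ, EM) x, mfderiv 𝓘(ℝ, EM) 𝓘(ℝ, EP) j x w = v := by
  set ψ := extChartAt 𝓘(ℝ, EP) (j x)
  set θ := extChartAt 𝓘(ℝ, EM) x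
  have hIP : IsManifold 𝓘(ℝ, EP) 1 P := IsManifold.of_le (n := ∞) (by simp)
  have hIM : IsManifold 𝓘(ℝ, EM) 1 M := IsManifold.of_le (n := ∞) (by simp)
  have hjx : j x ∈ ψ.source := mem_extChartAt_source _
  have hx : x ∈ θ.source := mem_extChartAt_source _
  have hψz : ψ.symm (ψ (j x)) = j x := ψ.left_inv hjx
  have hψs : ContMDiffAt 𝓘(ℝ, EP) 𝓘(ℝ, EP) ∞ ψ.symm (ψ (j x)) :=
    (contMDiffOn_extChartAt_symm (j x)).contMDiffAt (extChartAt_target_mem_nhds (j x))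
  have hψ : ContMDiffAt 𝓘(ℝ, EP) 𝓘(ℝ, EP) ∞ ψ (j x) := contMDiffAt_extChartAt
  have hθ : ContMDiffAt 𝓘(ℝ, EM) 𝓘(ℝ, EM) ∞ θ x := contMDiffAt_extChartAt
  have hθs : ContMDiffAt 𝓘(ℝ, EM) 𝓘(ℝ, EM) ∞ θ.symm (θ x) :=
    (contMDiffOn_extChartAt_symm x).contMDiffAt (extChartAt_target_mem_nhds x)
  have hrx : ContMDiffAt 𝓘(ℝ, EP) 𝓘(ℝ, EM) ∞ r (j x) := hr.self_of_nhds
  -- `g`, `a`, `b` are `η`, `j`, `r` in charts. Points with `g = 0` lie on `M`, where `j ∘ r` is the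
  -- identity; thus no dimension count for `M` is needed.
  let g : EP → (Fin c → ℝ) := fun z i => η i (ψ.symm z)
  let a : EM → EP := fun y => ψ (j (θ.symm y))
  let b : EP → EM := fun z => θ (r (ψ.symm z))
  have hb0 : b (ψ (j x)) = θ x := by simp only [b, hψz, hrj]
  have hrψ : ContMDiffAt 𝓘(ℝ, EP) 𝓘(ℝ, EM) ∞ (fun z => r (ψ.symm z)) (ψ (j x)) := by
    rw [← hψz] at hrx
    exact hrx.comp _ hψs
  have hg : ContDiffAt ℝ ∞ g (ψ (j x)) :=
    contDiffAt_pi.2 fun i => (((hη.smooth i) _).comp _ hψs).contDiffAt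
  have ha : ContDiffAt ℝ ∞ a (b (ψ (j x))) := by
    rw [hb0]
    refine ContMDiffAt.contDiffAt ?_
    have h1 : ContMDiffAt 𝓘(ℝ, EM) 𝓘(ℝ, EP) ∞ (fun y => j (θ.symm y)) (θ x) := (hj _).comp _ hθs
    have h2 : ContMDiffAt 𝓘(ℝ, EP) 𝓘(ℝ, EP) ∞ ψ (j (θ.symm (θ x))) := by
      rw [θ.left_inv hx]; exact hψ
    exact h2.comp (θ x) h1
  have hb : ContDiffAt ℝ ∞ b (ψ (j x)) := by
    refine ContMDiffAt.contDiffAt ?_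
    have h2 : ContMDiffAt 𝓘(ℝ, EM) 𝓘(ℝ, EM) ∞ θ (r (ψ.symm (ψ (j x)))) := by
      rw [hψz, hrj]; exact hθ
    exact h2.comp (ψ (j x)) hrψ
  have hzero : g (ψ (j x)) = 0 := by
    have h1 : j x ∈ {p | ∀ i, η i p = 0} := hη.zeroSet ▸ mem_range_self x
    funext i
    simp only [g, hψz]
    exact h1 i
  set D : EP →L[ℝ] EP := mfderiv 𝓘(ℝ, EP) 𝓘(ℝ, EP) ψ (j x)
  have hD : D.IsInvertible := isInvertible_mfderiv_extChartAt hjx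
  have hgD : ∀ i u, fderiv ℝ g (ψ (j x)) (D u) i = diff (E := EP) (η i) (j x) u := by
    intro i u
    have h1 : MDifferentiableAt 𝓘(ℝ, EP) 𝓘(ℝ, ℝ) (fun z => g z i) (ψ (j x)) :=
      (((hη.smooth i) _).comp _ hψs).mdifferentiableAt (by simp)
    have h2 := mfderiv_comp (j x) h1 (hψ.mdifferentiableAt (by simp))
    have h3 : (fun z => g z i) ∘ ψ =ᶠ[𝓝 (j x)] η i := by
      filter_upwards [extChartAt_source_mem_nhds (I := 𝓘(ℝ, EP)) (j x)] with q hq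
      simp only [Function.comp_apply, g]
      rw [ψ.left_inv hq]
    rw [h3.mfderiv_eq, mfderiv_eq_fderiv] at h2
    have h4 : fderiv ℝ (fun z => g z i) (ψ (j x)) =
        (ContinuousLinearMap.proj i).comp (fderiv ℝ g (ψ (j x))) :=
      ((ContinuousLinearMap.proj (R := ℝ) (φ := fun _ : Fin c => ℝ) i).hasFDerivAt.comp _
        (hg.differentiableAt (by simp)).hasFDerivAt).fderiv
    rw [h4] at h2
    exact (congrArg (fun L : EP →L[ℝ] ℝ => L u) h2).symm
  have hsurj : Function.Surjective (fderiv ℝ g (ψ (j x))) := by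
    rw [← ContinuousLinearMap.coe_coe, ← LinearMap.range_eq_top]
    -- A nonzero functional killing the range would be a linear relation between the differentials
    -- of the `η i`.
    by_contra hne
    obtain ⟨f, hf0, hf⟩ := Submodule.exists_le_ker_of_lt_top _ (lt_top_iff_ne_top.2 hne)
    have hli := Fintype.linearIndependent_iff.1 (hη.independent x)
      (fun i => f (Pi.single i 1)) ?_
    · apply hf0
      ext i
      simpa using hli i
    · have hfy : ∀ y : Fin c → ℝ, f y = ∑ i, f (Pi.single i 1) * y i := fun y => by
        conv_lhs => rw [pi_eq_sum_univ' y, map_sum]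
        simp only [map_smul, smul_eq_mul, mul_comm]
      refine ContinuousLinearMap.ext fun u => ?_
      have h1 : f (fderiv ℝ g (ψ (j x)) (D u)) = 0 := hf ⟨D u, rfl⟩
      rw [hfy] at h1
      rw [sum_apply]
      refine Eq.trans (Finset.sum_congr rfl fun i _ => ?_) h1
      exact congrArg (fun t : ℝ => f (Pi.single i 1) * t) (hgD i u).symm
  have hab : ∀ᶠ z in 𝓝 (ψ (j x)), g z = g (ψ (j x)) → a (b z) = z := by
    have h1 : ∀ᶠ z in 𝓝 (ψ (j x)), r (ψ.symm z) ∈ θ.source := by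
      refine hrψ.continuousAt.eventually_mem ?_
      rw [hψz, hrj]
      exact extChartAt_source_mem_nhds x
    filter_upwards [h1, extChartAt_target_mem_nhds (I := 𝓘(ℝ, EP)) (j x)] with z hz hzt hgz
    rw [hzero] at hgz
    obtain ⟨y, hy⟩ : ψ.symm z ∈ range j := by
      rw [hη.zeroSet]
      exact fun i => congrFun hgz i
    simp only [a, b, ← hy, hrj] at hz ⊢
    rw [θ.left_inv hz, hy, ψ.right_inv hzt]
  have hDv : fderiv ℝ g (ψ (j x)) (D v) = 0 := funext fun i => (hgD i v).trans (hv i)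
  have hmain := eq_fderiv_fderiv_of_level_set (hg.hasStrictFDerivAt (by simp)) hsurj
    (ha.differentiableAt (by simp)) (hb.differentiableAt (by simp)) hab hDv
  rw [hb0] at hmain ha
  set T : EM →L[ℝ] EM := mfderiv 𝓘(ℝ, EM) 𝓘(ℝ, EM) θ x
  have hT : T.IsInvertible := isInvertible_mfderiv_extChartAt hx
  obtain ⟨w, hw⟩ := hT.bijective.2 (fderiv ℝ b (ψ (j x)) (D v))
  refine ⟨w, hD.bijective.1 ?_⟩
  have h2 := mfderiv_comp x (hψ.mdifferentiableAt (by simp)) ((hj x).mdifferentiableAt (by simp))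
  have h3 := mfderiv_comp (I' := 𝓘(ℝ, EM)) x (g := a)
    (ha.contMDiffAt.mdifferentiableAt (by simp)) (hθ.mdifferentiableAt (by simp))
  have h4 : a ∘ θ =ᶠ[𝓝 x] ψ ∘ j := by
    filter_upwards [extChartAt_source_mem_nhds (I := 𝓘(ℝ, EM)) x] with q hq
    simp only [Function.comp_apply, a]
    rw [θ.left_inv hq]
  rw [h4.mfderiv_eq, h2, mfderiv_eq_fderiv] at h3
  have h5 := congrArg (fun L : EM →L[ℝ] EP => L w) h3
  refine Eq.trans h5 ?_
  change fderiv ℝ a (θ x) (T w) = D v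
  rw [hw, hmain]

end Presymplectic

/-! ### Directions in which the momentum map has zero differential -/

namespace Presymplectic

open Set Filter

section

variable {EP : Type*} [NormedAddCommGroup EP] [NormedSpace ℝ EP]
  {P : Type*} [TopologicalSpace P] [ChartedSpace EP P]
  {EM : Type*} [NormedAddCommGroup EM] [NormedSpace ℝ EM]
  {M : Type*} [TopologicalSpace M] [ChartedSpace EM M]
  {EG : Type*} [NormedAddCommGroup EG] [NormedSpace ℝ EG]
  {G : Type*} [TopologicalSpace G] [ChartedSpace EG G] [Group G] [MulAction G M]
  {σ : ∀ p : P, TangentSpace 𝓘(ℝ, EP) p →L[ℝ] TangentSpace 𝓘(ℝ, EP) p →L[ℝ] ℝ}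
  {j : M → P} {r : P → M} {c : ℕ} {η : Fin c → P → ℝ}

/-- Allows coefficient functions, frozen at a point `x`, to be absorbed into a single Lie algebra
element. -/
theorem fundamentalField_sum {m : ℕ} (a : Fin m → ℝ) (ξ : Fin m → GroupLieAlgebra 𝓘(ℝ, EG) G)
    (x : M) : fundamentalField (F := EM) (∑ i, a i • ξ i) x =
      ∑ i, a i • fundamentalField (F := EM) (ξ i) x := by
  let T : EG →L[ℝ] EM := mfderiv 𝓘(ℝ, EG) 𝓘(ℝ, EM) (fun g : G => g • x) 1
  have h : ∀ ζ : Fin m → EG, T (∑ i, a i • ζ i) = ∑ i, a i • T (ζ i) := fun ζ => by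
    rw [map_sum]
    simp only [map_smul]
  exact h ξ

/-- A vector field on `P` which is tangent to `M` and `σ`-orthogonal to it is, at each point of `M`,
the value of a fundamental vector field belonging to the kernel of `j^*σ`. -/
theorem KerInFundamental.exists_fundamentalField [IsManifold 𝓘(ℝ, EP) ∞ P]
    [IsManifold 𝓘(ℝ, EM) ∞ M]
    (hker : KerInFundamental EG G (pullbackForm (F := EM) j σ))
    (hj : ContMDiff 𝓘(ℝ, EM) 𝓘(ℝ, EP) ∞ j) (hrj : ∀ x, r (j x) = x)
    (hr : ∀ x, SmoothNear EP EM r (j x)) {Y : ∀ p : P, TangentSpace 𝓘(ℝ, EP) p}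
    (hY : IsSmoothField Y) (hYj : IsTangentTo (F := EM) j Y)
    (hYσ : ∀ (x : M) (w : TangentSpace 𝓘(ℝ, EM) x),
      σ (j x) (Y (j x)) (mfderiv 𝓘(ℝ, EM) 𝓘(ℝ, EP) j x w) = 0) (x : M) :
    ∃ ξ : GroupLieAlgebra 𝓘(ℝ, EG) G,
      mfderiv 𝓘(ℝ, EM) 𝓘(ℝ, EP) j x (fundamentalField ξ x) = Y (j x) ∧
      pullbackForm (F := EM) j σ x (fundamentalField ξ x) = 0 := by
  obtain ⟨Z, hZ, hZY⟩ := exists_smoothField_restriction hj hrj hr hY hYj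
  have hZ0 : ∀ y, pullbackForm (F := EM) j σ y (Z y) = 0 := by
    intro y
    refine ContinuousLinearMap.ext fun w => ?_
    change σ (j y) (mfderiv 𝓘(ℝ, EM) 𝓘(ℝ, EP) j y (Z y)) (mfderiv 𝓘(ℝ, EM) 𝓘(ℝ, EP) j y w) = 0
    rw [hZY, hYσ]
  obtain ⟨m, ξ, f, -, hf⟩ := hker Z hZ hZ0
  refine ⟨∑ i, f i x • ξ i, ?_, ?_⟩
  · rw [fundamentalField_sum, ← hf, hZY]
  · rw [fundamentalField_sum, ← hf, hZ0]

theorem IsConstraintBasis.diff_mfderiv_eq_zero (hη : IsConstraintBasis (E := EP) j η)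
    (hj : ContMDiff 𝓘(ℝ, EM) 𝓘(ℝ, EP) ∞ j) (i : Fin c) (x : M) (w : TangentSpace 𝓘(ℝ, EM) x) :
    diff (η i) (j x) (mfderiv 𝓘(ℝ, EM) 𝓘(ℝ, EP) j x w) = 0 := by
  have h1 := mfderiv_comp x ((hη.smooth i (j x)).mdifferentiableAt (by simp))
    ((hj x).mdifferentiableAt (by simp))
  have h2 : η i ∘ j = fun _ => 0 := funext fun y => by
    have : j y ∈ {p | ∀ i, η i p = 0} := hη.zeroSet ▸ mem_range_self y
    exact this i
  rw [h2, mfderiv_const] at h1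
  exact (congrArg (fun L : EM →L[ℝ] ℝ => L w) h1).symm

/-- At each point of `M`, the differential of a momentum map is annihilated by a `(c + 1)`-dimensional
subspace of the Lie algebra. -/
theorem IsMomentumMap.exists_linearIndependent_diff_eq_zero [FiniteDimensional ℝ EP]
    [IsManifold 𝓘(ℝ, EP) ∞ P] [T2Space P] [SecondCountableTopology P] [IsManifold 𝓘(ℝ, EM) ∞ M]
    (hσ : IsPresymplectic σ) (hj : ContMDiff 𝓘(ℝ, EM) 𝓘(ℝ, EP) ∞ j) (hrj : ∀ x, r (j x) = x)
    (hr : ∀ x, SmoothNear EP EM r (j x))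
    (hker : KerInFundamental EG G (pullbackForm (F := EM) j σ))
    (hη : IsConstraintBasis (E := EP) j η) {Xη : Fin c → ∀ p : P, TangentSpace 𝓘(ℝ, EP) p}
    (hXη : ∀ i, IsHamiltonianField σ (Xη i) (η i)) (htangent : ∀ i, IsTangentTo (F := EM) j (Xη i))
    {J : M → Module.Dual ℝ (GroupLieAlgebra 𝓘(ℝ, EG) G)}
    (hJ : IsMomentumMap (pullbackForm (F := EM) j σ) J) (x : M) :
    ∃ ξ : Fin (c + 1) → GroupLieAlgebra 𝓘(ℝ, EG) G, LinearIndependent ℝ ξ ∧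
      ∀ i, diff (E := EM) (fun y => J y (ξ i)) x = 0 := by
  obtain ⟨k, hk0, hk⟩ := hσ.degenerate_constantRank
  have hanti : ∀ p (u w : TangentSpace 𝓘(ℝ, EP) p), σ p u w = - σ p w u := by
    intro p u w
    have h := hσ.alternating p (u + w)
    simp only [map_add, add_apply, hσ.alternating] at h
    linarith
  obtain ⟨v₀, hv₀, hv₀0⟩ : ∃ v ∈ LinearMap.ker (σ (j x)).toLinearMap, v ≠ 0 := by
    refine Submodule.exists_mem_ne_zero_of_ne_bot fun h => ?_
    have := hk (j x)
    rw [h, finrank_bot] at this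
    omega
  have hv₀' : σ (j x) v₀ = 0 := hv₀
  obtain ⟨Y, hY, hYσ, hYx⟩ := exists_smoothField_mem_ker hσ.smooth hk hv₀'
  -- `dη_i(Y) = σ(X_{η_i}, Y) = -σ(Y, X_{η_i}) = 0`.
  have hYj : IsTangentTo (F := EM) j Y := fun y =>
    hη.exists_mfderiv_eq hj hrj (hr y) fun i => by
      rw [← (hXη i).eq, hanti, hYσ]
      simp
  obtain ⟨ξ₀, hξ₀, hξ₀Ω⟩ := hker.exists_fundamentalField hj hrj hr hY hYj
    (fun y w => by rw [hYσ]; rfl) x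
  choose ξ hξ hξΩ using fun i => hker.exists_fundamentalField hj hrj hr (hXη i).smooth (htangent i)
    (fun y w => by rw [(hXη i).eq, hη.diff_mfderiv_eq_zero hj]) x
  rw [hYx] at hξ₀
  -- `σ` sends these vectors to the independent forms `dη_i`; hence it is injective on their span,
  -- which therefore cannot contain `v₀`.
  have hLIX : LinearIndependent ℝ (fun i => Xη i (j x)) := by
    refine LinearIndependent.of_comp (σ (j x)).toLinearMap ?_
    convert hη.independent x using 1
    funext i
    exact (hXη i).eq (j x)
  have hspan : v₀ ∉ Submodule.span ℝ (range fun i => Xη i (j x)) := by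
    intro h
    obtain ⟨a, ha⟩ := (Submodule.mem_span_range_iff_exists_fun ℝ).1 h
    apply hv₀0
    have h1 : ∑ i, a i • diff (E := EP) (η i) (j x) = 0 := by
      rw [← hv₀', ← ha, map_sum]
      simp only [map_smul, (hXη _).eq]
    have h2 := Fintype.linearIndependent_iff.1 (hη.independent x) a h1
    rw [← ha]
    simp [h2]
  refine ⟨Fin.cons ξ₀ ξ, ?_, fun i => ?_⟩
  -- The linear map `ξ ↦ dj(ξ̃(x))`: independence of its values implies independence of the `ξ`.
  · let T : GroupLieAlgebra 𝓘(ℝ, EG) G →L[ℝ] TangentSpace 𝓘(ℝ, EP) (j x) :=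
      ContinuousLinearMap.comp (M₂ := EM) (mfderiv 𝓘(ℝ, EM) 𝓘(ℝ, EP) j x)
        (mfderiv 𝓘(ℝ, EG) 𝓘(ℝ, EM) (fun g : G => g • x) 1)
    refine LinearIndependent.of_comp T.toLinearMap ?_
    have hT : T ∘ (Fin.cons ξ₀ ξ : Fin (c + 1) → GroupLieAlgebra 𝓘(ℝ, EG) G) =
        Fin.cons v₀ fun i => Xη i (j x) := by
      funext i
      refine Fin.cases ?_ (fun i => ?_) i
      · exact hξ₀
      · exact hξ i
    have hcons : LinearIndependent ℝ
        (Fin.cons v₀ fun i => Xη i (j x) : Fin (c + 1) → TangentSpace 𝓘(ℝ, EP) (j x)) :=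
      linearIndependent_finCons.2 ⟨hLIX, hspan⟩
    rw [← hT] at hcons
    exact hcons
  · rw [← hJ.eq]
    refine Fin.cases ?_ (fun i => ?_) i
    · exact hξ₀Ω
    · exact hξΩ i

end

end Presymplectic

/-! ### From annihilated directions to a rank bound, and the conclusion -/

namespace Presymplectic

open Set Filter

/-- Rank–nullity: a matrix with `m` independent rows has rank `m`. -/
theorem finrank_orthogonal_add_eq {n m : ℕ} {a : Fin m → Fin n → ℝ} (ha : LinearIndependent ℝ a) :
    Module.finrank ℝ (LinearMap.ker (Matrix.mulVecLin (Matrix.of a))) + m = n := by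
  have h1 := (Matrix.mulVecLin (Matrix.of a)).finrank_range_add_finrank_ker
  have h2 : (Matrix.of a).rank = Fintype.card (Fin m) := LinearIndependent.rank_matrix ha
  rw [Matrix.rank] at h2
  rw [h2, Fintype.card_fin, Module.finrank_fin_fun] at h1
  omega

/-- If `n ≥ c + 1` and `c + 1` independent combinations of the components of a map to `ℝⁿ` have
vanishing differential at a point, then the rank of the map at this point is less than `n - c`. -/
theorem exists_mfderiv_mem_of_linearIndependent {EM : Type*} [NormedAddCommGroup EM]
    [NormedSpace ℝ EM] {M : Type*} [TopologicalSpace M] [ChartedSpace EM M] {n c : ℕ}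
    {F : M → (Fin n → ℝ)} {x : M}
    (hF : MDifferentiableAt 𝓘(ℝ, EM) 𝓘(ℝ, Fin n → ℝ) F x) {a : Fin (c + 1) → Fin n → ℝ}
    (ha : LinearIndependent ℝ a)
    (hd : ∀ i, diff (E := EM) (fun y => ∑ k, a i k * F y k) x = 0) :
    ∃ W : Submodule ℝ (Fin n → ℝ), Module.finrank ℝ W + c < n ∧
      ∀ v, mfderiv 𝓘(ℝ, EM) 𝓘(ℝ, Fin n → ℝ) F x v ∈ W := by
  have hW := finrank_orthogonal_add_eq ha
  refine ⟨LinearMap.ker (Matrix.mulVecLin (Matrix.of a)), by omega, fun v => ?_⟩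
  change Matrix.mulVecLin (Matrix.of a) (mfderiv 𝓘(ℝ, EM) 𝓘(ℝ, Fin n → ℝ) F x v) = 0
  funext i
  let L : (Fin n → ℝ) →L[ℝ] ℝ := ∑ k, a i k • ContinuousLinearMap.proj k
  have hL : ∀ y, L y = ∑ k, a i k * y k := fun y => by simp [L, sum_apply]
  have h1 := mfderiv_comp x (L.differentiableAt (x := F x)).mdifferentiableAt hF
  have h2 : L ∘ F = fun y => ∑ k, a i k * F y k := funext fun y => hL (F y)
  rw [h2, mfderiv_eq_fderiv, L.fderiv] at h1
  have h3 : diff (E := EM) (fun y => ∑ k, a i k * F y k) x v =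
      L (mfderiv 𝓘(ℝ, EM) 𝓘(ℝ, Fin n → ℝ) F x v) := congrArg (fun L : EM →L[ℝ] ℝ => L v) h1
  rw [hd] at h3
  exact (hL _).symm.trans h3.symm

theorem diff_sub_const {EM : Type*} [NormedAddCommGroup EM]
    [NormedSpace ℝ EM] {M : Type*} [TopologicalSpace M] [ChartedSpace EM M] {f : M → ℝ} {x : M}
    (hf : MDifferentiableAt 𝓘(ℝ, EM) 𝓘(ℝ, ℝ) f x) (t : ℝ) :
    diff (E := EM) (fun y => f y - t) x = diff f x := by
  have h1 := mfderiv_comp x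
    ((differentiableAt_id.sub_const t : DifferentiableAt ℝ (fun s : ℝ => s - t)
      (f x)).mdifferentiableAt) hf
  rw [mfderiv_eq_fderiv, fderiv_sub_const, fderiv_id] at h1
  exact h1.trans (ContinuousLinearMap.id_comp _)

end Presymplectic

theorem mainTheorem11
    {EP : Type*} [NormedAddCommGroup EP] [NormedSpace ℝ EP] [FiniteDimensional ℝ EP]
    {P : Type*} [TopologicalSpace P] [ChartedSpace EP P] [IsManifold 𝓘(ℝ, EP) ∞ P]
    [T2Space P] [SecondCountableTopology P] [ConnectedSpace P]
    {EM : Type*} [NormedAddCommGroup EM] [NormedSpace ℝ EM] [FiniteDimensional ℝ EM]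
    {M : Type*} [TopologicalSpace M] [ChartedSpace EM M] [IsManifold 𝓘(ℝ, EM) ∞ M]
    [T2Space M] [SecondCountableTopology M] [ConnectedSpace M]
    {EG : Type*} [NormedAddCommGroup EG] [NormedSpace ℝ EG] [FiniteDimensional ℝ EG]
    {G : Type*} [TopologicalSpace G] [ChartedSpace EG G] [Group G] [LieGroup 𝓘(ℝ, EG) ∞ G]
    [ConnectedSpace G]
    [MulAction G P] [ContMDiffSMul 𝓘(ℝ, EG) 𝓘(ℝ, EP) ∞ G P]
    [MulAction G M] [ContMDiffSMul 𝓘(ℝ, EG) 𝓘(ℝ, EM) ∞ G M]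
    (σ : ∀ p : P, TangentSpace 𝓘(ℝ, EP) p →L[ℝ] TangentSpace 𝓘(ℝ, EP) p →L[ℝ] ℝ)
    (hσ : Presymplectic.IsPresymplectic σ)
    (H : P → ℝ) (hH : ContMDiff 𝓘(ℝ, EP) 𝓘(ℝ, ℝ) ∞ H)
    (hincompatible : ¬ Presymplectic.IsCompatible σ H)
    (j : M → P) (hfinal : Presymplectic.IsFinalConstraintSubmanifold (F := EM) σ H j)
    (hsymm : Presymplectic.IsSymmetryGroup (F := EM) EG G σ H j)
    (hker : Presymplectic.KerInFundamental EG G (Presymplectic.pullbackForm (F := EM) j σ))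
    {c : ℕ} (η : Fin c → P → ℝ) (hη : Presymplectic.IsConstraintBasis (E := EP) j η)
    (Xη : Fin c → ∀ p : P, TangentSpace 𝓘(ℝ, EP) p)
    (hXη : ∀ i, Presymplectic.IsHamiltonianField σ (Xη i) (η i))
    (htangent : ∀ i, Presymplectic.IsTangentTo (F := EM) j (Xη i))
    (J : M → Module.Dual ℝ (GroupLieAlgebra 𝓘(ℝ, EG) G))
    (hJ : Presymplectic.IsMomentumMap (Presymplectic.pullbackForm (F := EM) j σ) J)
    (μ : Module.Dual ℝ (GroupLieAlgebra 𝓘(ℝ, EG) G)) :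
    ∃ K : P → Module.Dual ℝ (GroupLieAlgebra 𝓘(ℝ, EG) G),
      (∀ ξ, ContMDiff 𝓘(ℝ, EP) 𝓘(ℝ, ℝ) ∞ (fun p => K p ξ)) ∧
      (∀ x, K (j x) = J x) ∧
      K ⁻¹' {μ} = j '' (J ⁻¹' {μ}) := by 
  have hjs := hfinal.isSolution.embedding
  have hjc := hfinal.isSolution.closed
  obtain ⟨r, hrj, hr⟩ := Presymplectic.exists_smooth_retraction hjs hjc
  have : FiniteDimensional ℝ (GroupLieAlgebra 𝓘(ℝ, EG) G) := inferInstanceAs (FiniteDimensional ℝ EG)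
  let b := Module.finBasis ℝ (GroupLieAlgebra 𝓘(ℝ, EG) G)
  let F : M → (Fin (Module.finrank ℝ (GroupLieAlgebra 𝓘(ℝ, EG) G)) → ℝ) :=
    fun x k => J x (b k) - μ (b k)
  have hF : ContMDiff 𝓘(ℝ, EM)
      𝓘(ℝ, Fin (Module.finrank ℝ (GroupLieAlgebra 𝓘(ℝ, EG) G)) → ℝ) ∞ F :=
    contMDiff_pi_space.2 fun k => (hJ.smooth (b k)).sub contMDiff_const
  have hFJ : ∀ ξ x, ∑ k, b.repr ξ k * F x k = J x ξ - μ ξ := by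
    intro ξ x
    conv_rhs => rw [← LinearMap.sub_apply, ← b.sum_repr ξ, map_sum]
    simp [F]
  obtain ⟨K, hK, hKj, hK0⟩ := Presymplectic.exists_extension_without_new_zeros hjc hrj hr
    hη.smooth hη.zeroSet hF fun x => by
      obtain ⟨ξ, hξ, hξJ⟩ := hJ.exists_linearIndependent_diff_eq_zero hσ hjs.contMDiff hrj hr hker
        hη hXη htangent x
      -- With the coordinates of `ξ i` as coefficients, the combination of the components of `F` is
      -- `f_{ξ i}` minus a constant.
      refine Presymplectic.exists_mfderiv_mem_of_linearIndependent (a := fun i k => b.repr (ξ i) k)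
        ((hF x).mdifferentiableAt (by simp)) (hξ.map' b.equivFun.toLinearMap b.equivFun.ker) ?_
      intro i
      simp only [hFJ]
      rw [Presymplectic.diff_sub_const ((hJ.smooth (ξ i) x).mdifferentiableAt (by simp)), hξJ]
  have hext : ∀ p ξ, b.constr ℝ (fun k => μ (b k) + K p k) ξ =
      ∑ k, b.repr ξ k * (μ (b k) + K p k) := fun p ξ => by
    rw [b.constr_apply_fintype ℝ]; rfl
  have hKJ : ∀ x, b.constr ℝ (fun k => μ (b k) + K (j x) k) = J x := fun x =>
    b.ext fun k => by rw [b.constr_basis, hKj]; simp [F]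
  -- Adding `μ` back turns the zeros of `K` into the level set of `μ`.
  refine ⟨fun p => b.constr ℝ fun k => μ (b k) + K p k, fun ξ => ?_, hKJ, ?_⟩
  · simp only [hext]
    exact contMDiff_finsetSum fun k _ =>
      contMDiff_const.mul (contMDiff_const.add (contMDiff_pi_space.1 hK k))
  · ext p
    constructor
    · intro hp
      have hp' : b.constr ℝ (fun k => μ (b k) + K p k) = μ := hp
      have hKp : K p = 0 := funext fun k => by
        have := congrArg (fun f => f (b k)) hp'
        rw [b.constr_basis] at this
        simpa using this
      obtain ⟨x, rfl⟩ := hK0 p hKp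
      exact ⟨x, (hKJ x).symm.trans hp', rfl⟩
    · rintro ⟨x, hx, rfl⟩
      exact (hKJ x).trans hx
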